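/- Let $I\subset\mathbb R$ be a nonempty open interval and consider the class of equations $$u_t+\alpha(t)uu_x+\beta(t)u_{xxx}+\sigma(t)u_{xxxxx}=0,\qquad\qquad(*)$$ whose arbitrary elements $\theta=(\alpha,\beta,\sigma)$ are smooth nonvanishing functions on $I$. For every $\theta$ let $\int\alpha\,dt$ be a fixed antiderivative of $\alpha$ on $I$. A generalized extended equivalence transformation of the class assigns to every equation $\theta$ of the class a nondegenerate point transformation of the variables $(t,x,u)$ (defined on some domain over $I$ with connected time slices) and new arbitrary elements $\tilde\theta=(\tilde\alpha,\tilde\beta,\tilde\sigma)$, both possibly depending on $\theta$, also nonlocally, such that the point transformation maps the equation $\theta$ to the equation of the class with the arbitrary elements $\tilde\theta$. It is a usual equivalence transformation if it is induced by one nondegenerate point transformation of $(t,x,u,\alpha,\beta,\sigma)$ whose components for $t,x,u$ do not involve $\alpha,\beta,\sigma$. The generalized extended equivalence group of the class $(*)$ is formed by the transformations that for each $\theta$ are of the form $$\tilde t=T(t),\quad \tilde x=(x+\delta_1)X^1+\delta_0,\quad \tilde u=\frac{\delta_2}{X^1}u-\delta_2\delta_3(x+\delta_1),$$ $$\tilde\alpha(\tilde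 t)=\frac{(X^1)^2}{\delta_2T_t}\alpha(t),\quad \tilde\beta(\tilde t)=\frac{(X^1)^3}{T_t}\beta(t),\quad \tilde\sigma(\tilde t)=\frac{(X^1)^5}{T_t}\sigma(t),$$ where $X^1=\bigl(\delta_3\int\alpha(t)\,dt+\delta_4\bigr)^{-1}$ (on the times where this is defined), or, for $\delta_3=0$, of the Galilean form $$\tilde t=T(t),\quad \tilde x=\Bigl(x+\delta_1\int\alpha(t)\,dt\Bigr)X^1+\delta_0,\quad \tilde u=\frac{\delta_2}{X^1}(u+\delta_1),\qquad X^1=\delta_4^{-1},$$ with the same transformation law for $\alpha,\beta,\sigma$. Here $\delta_0,\dots,\delta_4$ are arbitrary constants with $\delta_2(\delta_3^2+\delta_4^2)\ne0$ and $T=T(t)$ is an arbitrary smooth function with $T_t\ne0$; each choice of them, the same for all $\theta$, gives such a transformation of the whole class, and in general they may be chosen differently for different $\theta$. The usual equivalence group of the class $(*)$ comprises exactly the transformations of the first form with $\delta_1=\delta_3=0$ (with constants, $T$ and domain that do not depend on $\theta$). -/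

import Mathlib

open scoped Topology ContDiff

/-- A triple of coefficients `(α, β, σ)` of a variable coefficient Kawahara equation
`u_t + α(t) u u_x + β(t) u_xxx + σ(t) u_xxxxx = 0`. -/
structure Coeffs where
  α : ℝ → ℝ
  β : ℝ → ℝ
  σ : ℝ → ℝ

namespace Coeffs

/-- The equation belongs to the class over the set of times `S`: its coefficients are smooth and
nonvanishing functions of the time on `S`. -/
def InClass (S : Set ℝ) (θ : Coeffs) : Prop :=
  (ContDiffOn ℝ ∞ θ.α S ∧ ContDiffOn ℝ ∞ θ.β S ∧ ContDiffOn ℝ ∞ θ.σ S) ∧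
    ∀ t ∈ S, θ.α t ≠ 0 ∧ θ.β t ≠ 0 ∧ θ.σ t ≠ 0

/-- The values of the arbitrary elements at the time `t`. -/
def value (θ : Coeffs) (t : ℝ) : ℝ × ℝ × ℝ := (θ.α t, θ.β t, θ.σ t)

/-- The fifth order jet of `f` at the point `q = (t, x)` lies on the manifold that the equation
with coefficients `θ` defines in the jet space. (Used only for `f` smooth near `q`.) -/
def HoldsAt (θ : Coeffs) (f : ℝ × ℝ → ℝ) (q : ℝ × ℝ) : Prop :=
  deriv (fun t => f (t, q.2)) q.1
    + θ.α q.1 * f q * deriv (fun x => f (q.1, x)) q.2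
    + θ.β q.1 * iteratedDeriv 3 (fun x => f (q.1, x)) q.2
    + θ.σ q.1 * iteratedDeriv 5 (fun x => f (q.1, x)) q.2 = 0

end Coeffs

/-- A map given on a domain of the space of the variables `(t, x, u)`. The domain is connected,
and so is each of its time slices; every point of an open set has arbitrarily small
neighbourhoods of this kind. -/
structure LocalMap where
  dom : Set (ℝ × ℝ × ℝ)
  toFun : ℝ × ℝ × ℝ → ℝ × ℝ × ℝ
  isOpen_dom : IsOpen dom
  isConnected_dom : IsConnected dom
  isPreconnected_slice : ∀ t : ℝ, IsPreconnected {y : ℝ × ℝ | (t, y) ∈ dom}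

namespace LocalMap

/-- The set of times `t` that occur in the domain. -/
def times (Φ : LocalMap) : Set ℝ := Prod.fst '' Φ.dom

/-- The set of new times `t̃` that occur in the image. -/
def newTimes (Φ : LocalMap) : Set ℝ := Prod.fst '' (Φ.toFun '' Φ.dom)

/-- `Φ` is a nondegenerate point transformation of the variables `(t, x, u)`: smooth and injective
with invertible Jacobian matrix. -/
def IsPointTransformation (Φ : LocalMap) : Prop :=
  ContDiffOn ℝ ∞ Φ.toFun Φ.dom ∧ Set.InjOn Φ.toFun Φ.dom ∧
    ∀ p ∈ Φ.dom, Function.Bijective (fderiv ℝ Φ.toFun p)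

/-- Near the point over `q = (t, x)` the map `Φ` carries the graph of the smooth function `f` into
the graph of the smooth function `g` near the point over `q' = (t̃, x̃)`. For a point
transformation `Φ` the image of the graph of `f` then is the graph of `g` locally, that is, the
prolongation of `Φ` sends the jets of `f` at `q` to the jets of `g` at `q'`. -/
def CarriesGraph (Φ : LocalMap) (f g : ℝ × ℝ → ℝ) (q q' : ℝ × ℝ) : Prop :=
  (q.1, q.2, f q) ∈ Φ.dom ∧ ContDiffAt ℝ ∞ f q ∧ ContDiffAt ℝ ∞ g q' ∧
    Φ.toFun (q.1, q.2, f q) = (q'.1, q'.2, g q') ∧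
    ∀ᶠ r in 𝓝 q, (Φ.toFun (r.1, r.2, f r)).2.2 =
      g ((Φ.toFun (r.1, r.2, f r)).1, (Φ.toFun (r.1, r.2, f r)).2.1)

end LocalMap

/-- `(θ, Φ, θ')` is an admissible transformation: `Φ` is a point transformation over the time
interval `I`, the coefficients `θ'` belong to the class on the set of new times, and the prolonged
transformation takes the manifold of the equation `θ` in the jet space to that of `θ'`. -/
def Admissible (I : Set ℝ) (θ : Coeffs) (Φ : LocalMap) (θ' : Coeffs) : Prop :=
  Φ.IsPointTransformation ∧ Φ.times ⊆ I ∧ θ'.InClass Φ.newTimes ∧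
    ∀ (f g : ℝ × ℝ → ℝ) (q q' : ℝ × ℝ), Φ.CarriesGraph f g q q' →
      (θ.HoldsAt f q ↔ θ'.HoldsAt g q')

/-- A generalized extended equivalence transformation of the class over `I`: a rule that gives, for
every equation `θ` of the class, a point transformation of `(t, x, u)` and new arbitrary elements,
both of which may depend on the arbitrary elements `θ`, also in a nonlocal way, such that `θ` is
mapped to an equation of the class with these new arbitrary elements. -/
def IsGeneralizedExtendedEquivalence (I : Set ℝ) (τ : Coeffs → LocalMap × Coeffs) : Prop :=
  ∀ θ : Coeffs, θ.InClass I → Admissible I θ (τ θ).1 (τ θ).2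

/-- The set of triples of nonzero values of the arbitrary elements. -/
def nonzeroValues : Set (ℝ × ℝ × ℝ) := {a | a.1 ≠ 0 ∧ a.2.1 ≠ 0 ∧ a.2.2 ≠ 0}

/-- A usual equivalence transformation of the class over `I`: it is given by one nondegenerate point
transformation `((t, x, u), (α, β, σ)) ↦ (Φ (t, x, u), F (t, x, u) (α, β, σ))` of the variables and
the arbitrary elements together, whose part `Φ` for the variables does not involve the arbitrary
elements, and it maps every equation of the class to an equation of the class. -/
def IsUsualEquivalence (I : Set ℝ) (τ : Coeffs → LocalMap × Coeffs) : Prop :=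
  ∃ (Φ : LocalMap) (F : ℝ × ℝ × ℝ → ℝ × ℝ × ℝ → ℝ × ℝ × ℝ),
    (ContDiffOn ℝ ∞ (fun z : (ℝ × ℝ × ℝ) × (ℝ × ℝ × ℝ) => (Φ.toFun z.1, F z.1 z.2))
        (Φ.dom ×ˢ nonzeroValues) ∧
      Set.InjOn (fun z : (ℝ × ℝ × ℝ) × (ℝ × ℝ × ℝ) => (Φ.toFun z.1, F z.1 z.2))
        (Φ.dom ×ˢ nonzeroValues) ∧
      ∀ z ∈ Φ.dom ×ˢ nonzeroValues, Function.Bijective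
        (fderiv ℝ (fun z : (ℝ × ℝ × ℝ) × (ℝ × ℝ × ℝ) => (Φ.toFun z.1, F z.1 z.2)) z)) ∧
    ∀ θ : Coeffs, θ.InClass I →
      (τ θ).1.dom = Φ.dom ∧ Set.EqOn (τ θ).1.toFun Φ.toFun Φ.dom ∧
      Admissible I θ (τ θ).1 (τ θ).2 ∧
      ∀ p ∈ Φ.dom, (τ θ).2.value (Φ.toFun p).1 = F p (θ.value p.1)

/-- The transformation of the coefficients on the set of times `J`:
`α̃(T) = X² α / (δ₂ T')`, `β̃(T) = X³ β / T'`, `σ̃(T) = X⁵ σ / T'`. -/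
def CoefficientLaw (J : Set ℝ) (δ₂ : ℝ) (T X : ℝ → ℝ) (θ θ' : Coeffs) : Prop :=
  ∀ t ∈ J, θ'.α (T t) = X t ^ 2 / (δ₂ * deriv T t) * θ.α t ∧
    θ'.β (T t) = X t ^ 3 / deriv T t * θ.β t ∧
    θ'.σ (T t) = X t ^ 5 / deriv T t * θ.σ t

/-- `Φ` and `θ'` are given, with `X¹ = (δ₃ A + δ₄)⁻¹`, by
`t̃ = T(t)`, `x̃ = (x + δ₁) X¹ + δ₀`, `ũ = (δ₂ / X¹) u - δ₂ δ₃ (x + δ₁)` and the law for the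
coefficients. Here `A` stands for the integral of `α`. -/
def HasForm (I : Set ℝ) (θ : Coeffs) (A : ℝ → ℝ) (δ : Fin 5 → ℝ) (T : ℝ → ℝ)
    (Φ : LocalMap) (θ' : Coeffs) : Prop :=
  Φ.times ⊆ I ∧ δ 2 * (δ 3 ^ 2 + δ 4 ^ 2) ≠ 0 ∧
    ContDiffOn ℝ ∞ T Φ.times ∧ (∀ t ∈ Φ.times, deriv T t ≠ 0) ∧
    (∀ t ∈ Φ.times, δ 3 * A t + δ 4 ≠ 0) ∧
    (∀ t x u : ℝ, (t, x, u) ∈ Φ.dom → Φ.toFun (t, x, u) =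
      (T t, (x + δ 1) * (δ 3 * A t + δ 4)⁻¹ + δ 0,
        δ 2 / (δ 3 * A t + δ 4)⁻¹ * u - δ 2 * δ 3 * (x + δ 1))) ∧
    CoefficientLaw Φ.times (δ 2) T (fun t => (δ 3 * A t + δ 4)⁻¹) θ θ'

/-- The Galilean transformations, with constant `X¹ = δ₄⁻¹`:
`t̃ = T(t)`, `x̃ = (x + δ₁ A) X¹ + δ₀`, `ũ = (δ₂ / X¹) (u + δ₁)`, with the same law for the
coefficients. Here `A` stands for the integral of `α`, and `δ 3` is `0`. -/
def HasGalileanForm (I : Set ℝ) (θ : Coeffs) (A : ℝ → ℝ) (δ : Fin 5 → ℝ) (T : ℝ → ℝ)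
    (Φ : LocalMap) (θ' : Coeffs) : Prop :=
  Φ.times ⊆ I ∧ δ 3 = 0 ∧ δ 2 * δ 4 ≠ 0 ∧
    ContDiffOn ℝ ∞ T Φ.times ∧ (∀ t ∈ Φ.times, deriv T t ≠ 0) ∧
    (∀ t x u : ℝ, (t, x, u) ∈ Φ.dom → Φ.toFun (t, x, u) =
      (T t, (x + δ 1 * A t) * (δ 4)⁻¹ + δ 0, δ 2 / (δ 4)⁻¹ * (u + δ 1))) ∧
    CoefficientLaw Φ.times (δ 2) T (fun _ => (δ 4)⁻¹) θ θ'

/-! A rule is a generalized extended equivalence exactly when it gives an admissible transformation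
for each `θ`, so the task is to find all admissible transformations of one equation. The class
prescribes no solutions with given jets, but admissibility speaks of jets at a single point, where
polynomials already realise every jet needed.

The main device compares two functions with the same value at a point, both satisfying the equation
there. The difference of their images satisfies a linear equation, because equal values make the
term `u u_x` linear in the difference; to first order this difference is a nonzero multiple of the
old one (`Admissible.exists_perturbation`). Suitable perturbations then give the structure of the
transformation one piece at a time. The perturbation `(t - t₀)^5` shows that the new time depends on
`t` only. Balancing `(x - x₀)^5` against a term linear in `t` gives `σ (D_x x̃)^5 = T' σ̃`, hence
`x̃ = X(t) x + Y(t)`. The perturbation `(x - x₀)^4` shows that `ũ_u` depends on `t` only. The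
remaining first and third order jets give the law for `β` and the formula for `ũ`.

Constants solve every equation of the class, and their images must be solutions too. This leaves `ũ
= (δ/X) u + c₁ x + c₀` with `X' = c₁ α X²/δ` and `Y' = c₀ α X²/δ`
(`Admissible.exists_hasAffineForm`). The equation for `X` is linear in `1/X`; integration yields the
first family, or the Galilean one when `c₁ = 0` (`HasAffineForm.exists_form`). Conversely, direct
substitution shows that every such affine form is admissible (`HasAffineForm.admissible`).

For a usual equivalence the same `X` and `Y` must satisfy these equations for different `α`, which
forces `c₁ = c₀ = 0`. What remains is a scaling and a shift, with coefficients multiplied by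
functions of the time. -/

open Filter Asymptotics

/-! ### Expansions at a point and the derivatives they determine -/

/-- A polynomial of degree at most `n` that is `o(yⁿ)` at the origin vanishes. -/
theorem coeff_eq_zero_of_isLittleO (n : ℕ) : ∀ a : ℕ → ℝ,
    (fun y : ℝ => ∑ k ∈ Finset.range (n + 1), a k * y ^ k) =o[𝓝[≠] 0] (fun y => y ^ n) →
    ∀ k ≤ n, a k = 0 := by
  have key : ∀ (n : ℕ) (a : ℕ → ℝ),
      (fun y : ℝ => ∑ k ∈ Finset.range (n + 1), a k * y ^ k) =o[𝓝[≠] 0] (fun y => y ^ n) →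
      a 0 = 0 := by
    intro n a h
    have hb : (fun y : ℝ => y ^ n) =O[𝓝[≠] 0] (fun _ => (1 : ℝ)) := by
      have : ContinuousAt (fun y : ℝ => y ^ n) 0 := by fun_prop
      exact (this.tendsto.mono_left nhdsWithin_le_nhds).isBigO_one ℝ
    have h1 := (isLittleO_one_iff ℝ).1 (h.trans_isBigO hb)
    have h2 : Tendsto (fun y : ℝ => ∑ k ∈ Finset.range (n + 1), a k * y ^ k) (𝓝[≠] 0)
        (𝓝 (∑ k ∈ Finset.range (n + 1), a k * (0 : ℝ) ^ k)) := by
      have : ContinuousAt (fun y : ℝ => ∑ k ∈ Finset.range (n + 1), a k * y ^ k) 0 := by fun_prop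
      exact this.tendsto.mono_left nhdsWithin_le_nhds
    have h3 := tendsto_nhds_unique h1 h2
    rw [Finset.sum_range_succ'] at h3
    simpa using h3.symm
  induction n with
  | zero => intro a h k hk; obtain rfl : k = 0 := by omega
            exact key 0 a h
  | succ n ih =>
    intro a h k hk
    have h0 := key _ a h
    rcases k with _ | k
    · exact h0
    -- Without its constant term the polynomial is divisible by `y`; the neighbourhood is punctured
    -- so that `y` can be cancelled.
    refine ih (fun k => a (k + 1)) ?_ k (by omega)
    rw [isLittleO_iff] at h ⊢
    intro c hc
    filter_upwards [h hc, self_mem_nhdsWithin] with y hy hy0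
    have hy0 : 0 < ‖y‖ := norm_pos_iff.2 hy0
    rw [Finset.sum_range_succ', h0, zero_mul, add_zero] at hy
    simp only [pow_succ, ← mul_assoc, ← Finset.sum_mul, norm_mul] at hy
    exact le_of_mul_le_mul_right hy hy0

/-- The derivatives at `y₀` of a function with a known expansion of order five. -/
theorem derivs_of_expansion {φ : ℝ → ℝ} {y₀ K L : ℝ} (hφ : ContDiffAt ℝ ∞ φ y₀)
    (h : (fun y => φ y - (K * (y - y₀) ^ 4 + L * (y - y₀) ^ 5)) =o[𝓝 y₀] fun y => (y - y₀) ^ 5) :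
    deriv φ y₀ = 0 ∧ iteratedDeriv 3 φ y₀ = 0 ∧ iteratedDeriv 5 φ y₀ = 120 * L := by
  have hφ5 : ContDiffAt ℝ 5 φ y₀ := contDiffAt_infty.1 hφ 5
  obtain ⟨u, hu, hφu⟩ := hφ5.contDiffOn (m := 5) le_rfl (by simp)
  obtain ⟨ε, hε, hball⟩ := Metric.mem_nhds_iff.1 (by simpa using hu)
  have hy0 : y₀ ∈ Metric.ball y₀ ε := Metric.mem_ball_self hε
  have ht := taylor_isLittleO (n := 5) (convex_ball y₀ ε) hy0 (hφu.mono hball)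
  rw [Metric.isOpen_ball.nhdsWithin_eq hy0] at ht
  have hk : ∀ k : ℕ, k ≤ 5 → iteratedDerivWithin k φ (Metric.ball y₀ ε) y₀ = iteratedDeriv k φ y₀ :=
    fun k hk => iteratedDerivWithin_eq_iteratedDeriv Metric.isOpen_ball.uniqueDiffOn
      (hφ5.of_le (by exact_mod_cast hk)) hy0
  have hs := (h.sub ht).comp_tendsto
    (k := fun y => y + y₀) (l' := 𝓝[≠] (0 : ℝ)) (by
      have : ContinuousAt (fun y : ℝ => y + y₀) 0 := by fun_prop
      simpa using this.tendsto.mono_left nhdsWithin_le_nhds)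
  -- The Taylor coefficients minus those of the given expansion: both expansions are correct up to
  -- `o(y^5)`, so this polynomial vanishes.
  set a : ℕ → ℝ := fun k => iteratedDeriv k φ y₀ / (k.factorial : ℝ) - (if k = 4 then K else 0)
    - (if k = 5 then L else 0) with ha
  have hz := coeff_eq_zero_of_isLittleO 5 a (by
    refine (hs.congr_left ?_).congr_right ?_
    · intro y
      simp only [Function.comp, taylorWithinEval_succ, taylor_within_zero_eval, ha,
        Finset.sum_range_succ, Finset.sum_range_zero, hk 1 (by norm_num), hk 2 (by norm_num),
        hk 3 (by norm_num), hk 4 (by norm_num), hk 5 (by norm_num), add_sub_cancel_right,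
        iteratedDeriv_zero, Nat.factorial, smul_eq_mul]
      norm_num
      ring
    · intro y; simp [Function.comp])
  have h1 := hz 1 (by norm_num)
  have h3 := hz 3 (by norm_num)
  have h5 := hz 5 (by norm_num)
  simp [ha, Nat.factorial] at h1 h3 h5
  refine ⟨h1, h3, ?_⟩
  linarith

theorem iteratedDeriv_comp_affine (w : ℝ → ℝ) (m c : ℝ) (n : ℕ) (x : ℝ) :
    iteratedDeriv n (fun x => w (m * x + c)) x = m ^ n * iteratedDeriv n w (m * x + c) := by
  induction n generalizing x with
  | zero => simp
  | succ n ih =>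
    rw [iteratedDeriv_succ, funext ih, iteratedDeriv_succ, deriv_const_mul_field]
    have h1 := deriv_comp_mul_left m (fun z => iteratedDeriv n w (z + c)) x
    have h2 := deriv_comp_add_const (iteratedDeriv n w) c (m * x)
    rw [h1, h2, smul_eq_mul]
    ring

/-- A smooth map with injective derivative between spaces of the same finite dimension has a smooth
local inverse. -/
theorem exists_smooth_localInverse {E : Type*} [NormedAddCommGroup E] [NormedSpace ℝ E]
    [FiniteDimensional ℝ E] {F : E → E} {q : E} (hF : ContDiffAt ℝ ∞ F q)
    (hinj : ∀ v, fderiv ℝ F q v = 0 → v = 0) :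
    ∃ R : E → E, ContDiffAt ℝ ∞ R (F q) ∧ R (F q) = q ∧ (∀ᶠ r in 𝓝 q, R (F r) = r) ∧
      ∀ᶠ s in 𝓝 (F q), F (R s) = s := by
  have : CompleteSpace E := FiniteDimensional.complete ℝ E
  have hi : Function.Injective (fderiv ℝ F q : E →ₗ[ℝ] E) :=
    (injective_iff_map_eq_zero _).2 hinj
  let e : E ≃L[ℝ] E := (LinearEquiv.ofInjectiveEndo _ hi).toContinuousLinearEquiv
  have he : (e : E →L[ℝ] E) = fderiv ℝ F q := by ext v; rfl
  have hd : HasFDerivAt F (e : E →L[ℝ] E) q := by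
    rw [he]; exact (hF.differentiableAt (by simp)).hasFDerivAt
  have hs := hF.hasStrictFDerivAt' hd (by simp)
  exact ⟨hF.localInverse hd (by simp), hF.to_localInverse hd (by simp),
    hF.localInverse_apply_image hd (by simp), hs.eventually_left_inverse,
    hs.eventually_right_inverse⟩

/-- A function with nonvanishing derivative on an interval is injective there. -/
theorem injOn_of_deriv_ne_zero {T : ℝ → ℝ} {J : Set ℝ} (hJ : J.OrdConnected)
    (hT : ∀ t ∈ J, deriv T t ≠ 0) : Set.InjOn T J := by
  have key : ∀ a ∈ J, ∀ b ∈ J, a < b → T a ≠ T b := by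
    intro a ha b hb hab h
    have hsub : Set.Icc a b ⊆ J := hJ.out ha hb
    obtain ⟨c, hc, hc0⟩ := exists_deriv_eq_zero hab
      (fun t ht => (differentiableAt_of_deriv_ne_zero (hT t (hsub ht))).continuousAt.continuousWithinAt) h
    exact hT c (hsub (Set.Ioo_subset_Icc_self hc)) hc0
  intro a ha b hb h
  rcases lt_trichotomy a b with hab | hab | hab
  · exact absurd h (key a ha b hb hab)
  · exact hab
  · exact absurd h.symm (key b hb a ha hab)

/-! ### Polynomials with prescribed jets and perturbations of jets -/

/-- A polynomial with prescribed derivatives at the point `(t₀, x₀)`. -/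
def jetPoly (q : ℝ × ℝ) (u a b c e d k : ℝ) (r : ℝ × ℝ) : ℝ :=
  u + a * (r.1 - q.1) + k * (r.1 - q.1) ^ 5 + b * (r.2 - q.2) + c * (r.2 - q.2) ^ 3
    + e * (r.2 - q.2) ^ 4 + d * (r.2 - q.2) ^ 5

theorem contDiff_jetPoly (q : ℝ × ℝ) (u a b c e d k : ℝ) :
    ContDiff ℝ ∞ (jetPoly q u a b c e d k) := by
  unfold jetPoly; fun_prop

@[simp]
theorem jetPoly_self (q : ℝ × ℝ) (u a b c e d k : ℝ) : jetPoly q u a b c e d k q = u := by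
  simp [jetPoly]

theorem hasFDerivAt_jetPoly (q : ℝ × ℝ) (u a b c e d k : ℝ) :
    HasFDerivAt (jetPoly q u a b c e d k)
      (a • ContinuousLinearMap.fst ℝ ℝ ℝ + b • ContinuousLinearMap.snd ℝ ℝ ℝ) q := by
  have h1 : HasFDerivAt (fun r : ℝ × ℝ => r.1 - q.1) (ContinuousLinearMap.fst ℝ ℝ ℝ) q :=
    hasFDerivAt_fst.sub_const _
  have h2 : HasFDerivAt (fun r : ℝ × ℝ => r.2 - q.2) (ContinuousLinearMap.snd ℝ ℝ ℝ) q :=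
    hasFDerivAt_snd.sub_const _
  have := (((((h1.const_mul a).const_add u).add ((h1.pow 5).const_mul k)).add
    (h2.const_mul b)).add ((h2.pow 3).const_mul c)).add ((h2.pow 4).const_mul e) |>.add
    ((h2.pow 5).const_mul d)
  refine this.congr_fderiv ?_
  ext <;> simp

theorem derivs_jetPoly (q : ℝ × ℝ) (u a b c e d k : ℝ) :
    HasDerivAt (fun t => jetPoly q u a b c e d k (t, q.2)) a q.1 ∧
    deriv (fun x => jetPoly q u a b c e d k (q.1, x)) q.2 = b ∧
    iteratedDeriv 3 (fun x => jetPoly q u a b c e d k (q.1, x)) q.2 = 6 * c ∧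
    iteratedDeriv 5 (fun x => jetPoly q u a b c e d k (q.1, x)) q.2 = 120 * d := by
  have hx : ∀ p0 p1 p2 p3 p4 p5 : ℝ, deriv (fun x : ℝ => p0 + p1 * (x - q.2) + p2 * (x - q.2) ^ 2
      + p3 * (x - q.2) ^ 3 + p4 * (x - q.2) ^ 4 + p5 * (x - q.2) ^ 5) =
      fun x => p1 + 2 * p2 * (x - q.2) + 3 * p3 * (x - q.2) ^ 2
      + 4 * p4 * (x - q.2) ^ 3 + 5 * p5 * (x - q.2) ^ 4 + 0 * (x - q.2) ^ 5 := by
    intro p0 p1 p2 p3 p4 p5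
    funext x
    have h1 : HasDerivAt (fun x : ℝ => x - q.2) 1 x := (hasDerivAt_id _).sub_const _
    have h := (((((h1.const_mul p1).const_add p0).add ((h1.pow 2).const_mul p2)).add
      ((h1.pow 3).const_mul p3)).add ((h1.pow 4).const_mul p4)).add ((h1.pow 5).const_mul p5)
    refine h.deriv.trans ?_
    norm_num
    ring
  have hf : (fun x => jetPoly q u a b c e d k (q.1, x)) = fun x : ℝ => u + b * (x - q.2)
      + 0 * (x - q.2) ^ 2 + c * (x - q.2) ^ 3 + e * (x - q.2) ^ 4 + d * (x - q.2) ^ 5 := by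
    funext x; simp [jetPoly]
  refine ⟨?_, ?_⟩
  · have h1 : HasDerivAt (fun t : ℝ => t - q.1) 1 q.1 := (hasDerivAt_id _).sub_const _
    have h : HasDerivAt (fun t : ℝ => u + a * (t - q.1) + k * (t - q.1) ^ 5)
      (a * 1 + k * (((5 : ℕ) : ℝ) * (q.1 - q.1) ^ 4 * 1)) q.1 :=
      ((h1.const_mul a).const_add u).add ((h1.pow 5).const_mul k)
    simpa [jetPoly] using h
  · rw [hf]
    simp only [iteratedDeriv_succ, iteratedDeriv_zero, hx]
    norm_num
    constructor <;> ring

/-- The parameters `e` and `k`, of `(x - x₀)^4` and `(t - t₀)^5`, do not enter: the equation does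
not see them at `q`. Changing them keeps the equation satisfied, and this freedom is what the
perturbation arguments exploit. -/
theorem Coeffs.holdsAt_jetPoly (θ : Coeffs) (q : ℝ × ℝ) (u a b c e d k : ℝ) :
    θ.HoldsAt (jetPoly q u a b c e d k) q ↔
      a + θ.α q.1 * u * b + θ.β q.1 * (6 * c) + θ.σ q.1 * (120 * d) = 0 := by
  obtain ⟨h1, h2, h3, h4⟩ := derivs_jetPoly q u a b c e d k
  unfold Coeffs.HoldsAt
  rw [h1.deriv, h2, h3, h4, jetPoly_self]

/-- Since `η = O(y - y₀)`, an error `o(η)` does not affect the first derivative. This gives the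
derivatives in the new time of a difference of images. -/
theorem hasDerivAt_of_isLittleO_sub {φ η : ℝ → ℝ} {c m y₀ : ℝ} (hη : HasDerivAt η m y₀)
    (h0 : η y₀ = 0) (h : (fun y => φ y - c * η y) =o[𝓝 y₀] η) : HasDerivAt φ (c * m) y₀ := by
  have hφ0 : φ y₀ = 0 := by
    have := (h.def one_pos).self_of_nhds
    simpa [h0] using this
  have hO : η =O[𝓝 y₀] fun y => y - y₀ := by
    simpa [h0] using hη.isBigO_sub
  rw [hasDerivAt_iff_isLittleO] at hη ⊢
  refine ((h.trans_isBigO hO).add (hη.const_mul_left c)).congr_left fun y => ?_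
  simp only [hφ0, h0, smul_eq_mul]
  ring

/-- Differentiability of `τ` alone gives `(τ y - τ y₀)^5 = M^5 (y - y₀)^5 + o((y - y₀)^5)`. No
higher derivatives of the old variable as a function of the new one are ever needed. -/
theorem derivs_of_perturbation {φ τ : ℝ → ℝ} {c M y₀ : ℝ} (hφ : ContDiffAt ℝ ∞ φ y₀)
    (hτ : HasDerivAt τ M y₀)
    (h : (fun y => φ y - c * (τ y - τ y₀) ^ 5) =o[𝓝 y₀] fun y => (τ y - τ y₀) ^ 5) :
    deriv φ y₀ = 0 ∧ iteratedDeriv 3 φ y₀ = 0 ∧ iteratedDeriv 5 φ y₀ = 120 * (c * M ^ 5) := by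
  have hO : (fun y => τ y - τ y₀) =O[𝓝 y₀] fun y => y - y₀ := hτ.isBigO_sub
  have hO1 : (fun y : ℝ => M * (y - y₀)) =O[𝓝 y₀] fun y => y - y₀ :=
    isBigO_const_mul_self _ _ _
  have hd : (fun y => (τ y - τ y₀) - M * (y - y₀)) =o[𝓝 y₀] fun y => y - y₀ :=
    (hasDerivAt_iff_isLittleO.1 hτ).congr_left fun y => by simp only [smul_eq_mul]; ring
  -- The cofactor of `p - q` in `p^5 - q^5`, with `p = τ y - τ y₀` and `q = M (y - y₀)`.
  have hq : (fun y => (τ y - τ y₀) ^ 4 + (τ y - τ y₀) ^ 3 * (M * (y - y₀))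
      + (τ y - τ y₀) ^ 2 * (M * (y - y₀)) ^ 2 + (τ y - τ y₀) * (M * (y - y₀)) ^ 3
      + (M * (y - y₀)) ^ 4) =O[𝓝 y₀] fun y => (y - y₀) ^ 4 := by
    refine ((((hO.pow 4).add ?_).add ?_).add ?_).add (hO1.pow 4)
    · exact ((hO.pow 3).mul hO1).congr_right fun y => by ring
    · exact ((hO.pow 2).mul (hO1.pow 2)).congr_right fun y => by ring
    · exact (hO.mul (hO1.pow 3)).congr_right fun y => by ring
  have h5 : (fun y => (τ y - τ y₀) ^ 5 - M ^ 5 * (y - y₀) ^ 5) =o[𝓝 y₀] fun y => (y - y₀) ^ 5 :=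
    ((hd.mul_isBigO hq).congr_left fun y => by ring).congr_right fun y => by ring
  refine derivs_of_expansion (K := 0) hφ
    (((h.trans_isBigO (hO.pow 5)).add (h5.const_mul_left c)).congr_left fun y => by ring)

/-- With equal values at `q` the quadratic terms differ by the common value times the difference of
slopes, so subtraction leaves a linear equation. -/
theorem Coeffs.holdsAt_sub {θ : Coeffs} {g g₂ : ℝ × ℝ → ℝ} {q : ℝ × ℝ}
    (hg : ContDiffAt ℝ ∞ g q) (hg₂ : ContDiffAt ℝ ∞ g₂ q) (hval : g₂ q = g q)
    (h : θ.HoldsAt g q) (h₂ : θ.HoldsAt g₂ q) :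
    deriv (fun t => g₂ (t, q.2) - g (t, q.2)) q.1
    + θ.α q.1 * g q * deriv (fun x => g₂ (q.1, x) - g (q.1, x)) q.2
    + θ.β q.1 * iteratedDeriv 3 (fun x => g₂ (q.1, x) - g (q.1, x)) q.2
    + θ.σ q.1 * iteratedDeriv 5 (fun x => g₂ (q.1, x) - g (q.1, x)) q.2 = 0 := by
  have ht : ∀ {w : ℝ × ℝ → ℝ}, ContDiffAt ℝ ∞ w q → ContDiffAt ℝ ∞ (fun t => w (t, q.2)) q.1 :=
    fun hw => ContDiffAt.comp (g := _) q.1 (by simpa using hw) (by fun_prop)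
  have hx : ∀ {w : ℝ × ℝ → ℝ}, ContDiffAt ℝ ∞ w q → ContDiffAt ℝ ∞ (fun x => w (q.1, x)) q.2 :=
    fun hw => ContDiffAt.comp (g := _) q.2 (by simpa using hw) (by fun_prop)
  have e1 := deriv_fun_sub ((ht hg₂).differentiableAt (by simp)) ((ht hg).differentiableAt (by simp))
  have e2 := deriv_fun_sub ((hx hg₂).differentiableAt (by simp)) ((hx hg).differentiableAt (by simp))
  have e3 := iteratedDeriv_fun_sub (contDiffAt_infty.1 (hx hg₂) 3) (contDiffAt_infty.1 (hx hg) 3)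
  have e5 := iteratedDeriv_fun_sub (contDiffAt_infty.1 (hx hg₂) 5) (contDiffAt_infty.1 (hx hg) 5)
  rw [e1, e2, e3, e5]
  unfold Coeffs.HoldsAt at h h₂
  rw [hval] at h₂
  linear_combination h₂ - h

/-! ### Images of graphs under a point transformation -/

namespace LocalMap

/-- The new independent variables on the graph of `f`. -/
def base (Φ : LocalMap) (f : ℝ × ℝ → ℝ) (r : ℝ × ℝ) : ℝ × ℝ :=
  ((Φ.toFun (r.1, r.2, f r)).1, (Φ.toFun (r.1, r.2, f r)).2.1)

variable {Φ : LocalMap} {f f₂ g g₂ : ℝ × ℝ → ℝ} {q q' : ℝ × ℝ}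

theorem IsPointTransformation.contDiffAt (hΦ : Φ.IsPointTransformation) {p : ℝ × ℝ × ℝ}
    (hp : p ∈ Φ.dom) : ContDiffAt ℝ ∞ Φ.toFun p :=
  hΦ.1.contDiffAt (Φ.isOpen_dom.mem_nhds hp)

theorem IsPointTransformation.hasFDerivAt (hΦ : Φ.IsPointTransformation) {p : ℝ × ℝ × ℝ}
    (hp : p ∈ Φ.dom) : HasFDerivAt Φ.toFun (fderiv ℝ Φ.toFun p) p :=
  ((hΦ.contDiffAt hp).differentiableAt (by simp)).hasFDerivAt

theorem contDiffAt_graph (hf : ContDiffAt ℝ ∞ f q) :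
    ContDiffAt ℝ ∞ (fun r : ℝ × ℝ => (r.1, r.2, f r)) q := by fun_prop

theorem IsPointTransformation.contDiffAt_base (hΦ : Φ.IsPointTransformation)
    (hf : ContDiffAt ℝ ∞ f q) (hq : (q.1, q.2, f q) ∈ Φ.dom) : ContDiffAt ℝ ∞ (Φ.base f) q := by
  have h : ContDiffAt ℝ ∞ (fun r : ℝ × ℝ => Φ.toFun (r.1, r.2, f r)) q :=
    (hΦ.contDiffAt hq).comp q (contDiffAt_graph hf)
  unfold base
  fun_prop

theorem hasFDerivAt_graph {f' : ℝ × ℝ →L[ℝ] ℝ} (hf : HasFDerivAt f f' q) :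
    HasFDerivAt (fun r : ℝ × ℝ => (r.1, r.2, f r))
      ((ContinuousLinearMap.fst ℝ ℝ ℝ).prod ((ContinuousLinearMap.snd ℝ ℝ ℝ).prod f')) q :=
  hasFDerivAt_fst.prodMk (hasFDerivAt_snd.prodMk hf)

theorem IsPointTransformation.hasFDerivAt_base (hΦ : Φ.IsPointTransformation)
    {f' : ℝ × ℝ →L[ℝ] ℝ} (hf : HasFDerivAt f f' q) (hq : (q.1, q.2, f q) ∈ Φ.dom) :
    HasFDerivAt (Φ.base f)
      (((ContinuousLinearMap.id ℝ ℝ).prodMap (ContinuousLinearMap.fst ℝ ℝ ℝ)).comp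
        ((fderiv ℝ Φ.toFun (q.1, q.2, f q)).comp
        ((ContinuousLinearMap.fst ℝ ℝ ℝ).prod ((ContinuousLinearMap.snd ℝ ℝ ℝ).prod f')))) q := by
  have h := (hΦ.hasFDerivAt hq).comp q (hasFDerivAt_graph hf)
  exact (((ContinuousLinearMap.id ℝ ℝ).prodMap
    (ContinuousLinearMap.fst ℝ ℝ ℝ)).hasFDerivAt).comp q h

theorem CarriesGraph.eq_base (h : Φ.CarriesGraph f g q q') : q' = Φ.base f q := by
  have := h.2.2.2.1
  simp [base, this]

theorem CarriesGraph.eventually_eq (h : Φ.CarriesGraph f g q q') :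
    ∀ᶠ r in 𝓝 q, g (Φ.base f r) = (Φ.toFun (r.1, r.2, f r)).2.2 := by
  filter_upwards [h.2.2.2.2] with r hr using hr.symm

/-- A graph transversal to the fibres of the new dependent variable is carried to a graph. -/
theorem IsPointTransformation.exists_carriesGraph (hΦ : Φ.IsPointTransformation)
    (hf : ContDiffAt ℝ ∞ f q) (hq : (q.1, q.2, f q) ∈ Φ.dom)
    (hinj : ∀ v, fderiv ℝ (Φ.base f) q v = 0 → v = 0) :
    ∃ (g : ℝ × ℝ → ℝ) (R : ℝ × ℝ → ℝ × ℝ), Φ.CarriesGraph f g q (Φ.base f q) ∧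
      ContDiffAt ℝ ∞ R (Φ.base f q) ∧ R (Φ.base f q) = q ∧
      ∀ᶠ s in 𝓝 (Φ.base f q), Φ.base f (R s) = s := by
  obtain ⟨R, hR, hRq, hl, hr⟩ := exists_smooth_localInverse (hΦ.contDiffAt_base hf hq) hinj
  refine ⟨fun s => (Φ.toFun ((R s).1, (R s).2, f (R s))).2.2, R, ⟨hq, hf, ?_, ?_, ?_⟩, hR, hRq, hr⟩
  · have h1 : ContDiffAt ℝ ∞ (fun r : ℝ × ℝ => (Φ.toFun (r.1, r.2, f r)).2.2) (R (Φ.base f q)) := by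
      rw [hRq]
      have h : ContDiffAt ℝ ∞ (fun r : ℝ × ℝ => Φ.toFun (r.1, r.2, f r)) q :=
        (hΦ.contDiffAt hq).comp q (contDiffAt_graph hf)
      fun_prop
    exact h1.comp _ hR
  · simp only [hRq]; rfl
  · filter_upwards [hl] with r hr
    change _ = (Φ.toFun ((R (Φ.base f r)).1, (R (Φ.base f r)).2, f (R (Φ.base f r)))).2.2
    rw [hr]

/-- First order effect of a change of `f` on the transformed function. -/
theorem CarriesGraph.isLittleO_sub (hΦ : Φ.IsPointTransformation)
    (h : Φ.CarriesGraph f g q q') (h₂ : Φ.CarriesGraph f₂ g₂ q q') (hval : f₂ q = f q) :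
    ∃ c ≠ 0, (fun r => g₂ (Φ.base f₂ r) - g (Φ.base f₂ r) - c * (f₂ r - f r))
      =o[𝓝 q] fun r => f₂ r - f r := by
  have hp := h.1
  set p : ℝ × ℝ × ℝ := (q.1, q.2, f q) with hpdef
  set D := fderiv ℝ Φ.toFun p with hD
  have hDs : HasStrictFDerivAt Φ.toFun D p := (hΦ.contDiffAt hp).hasStrictFDerivAt (by simp)
  have hgs : HasStrictFDerivAt g (fderiv ℝ g q') ((Φ.toFun p).1, (Φ.toFun p).2.1) := by
    have : ((Φ.toFun p).1, (Φ.toFun p).2.1) = q' := h.eq_base.symm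
    rw [this]; exact h.2.2.1.hasStrictFDerivAt (by simp)
  let pr : ℝ × ℝ × ℝ →L[ℝ] ℝ × ℝ :=
    (ContinuousLinearMap.id ℝ ℝ).prodMap (ContinuousLinearMap.fst ℝ ℝ ℝ)
  let pu : ℝ × ℝ × ℝ →L[ℝ] ℝ := (ContinuousLinearMap.snd ℝ ℝ ℝ).comp (ContinuousLinearMap.snd ℝ ℝ _)
  -- The defining function `ũ - g(t̃, x̃)` of the graph of `g`, pulled back by `Φ`. It vanishes on
  -- the graph of `f`, so its derivative kills the tangent plane there.
  let ψ : ℝ × ℝ × ℝ → ℝ := fun z => pu (Φ.toFun z) - g (pr (Φ.toFun z))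
  set P : ℝ × ℝ × ℝ →L[ℝ] ℝ := pu.comp D - (fderiv ℝ g q').comp (pr.comp D) with hP
  have hψ : HasStrictFDerivAt ψ P p :=
    (pu.hasStrictFDerivAt.comp p hDs).sub
      (HasStrictFDerivAt.comp (g := g) p hgs (pr.hasStrictFDerivAt.comp p hDs))
  have hfd := (h.2.1.differentiableAt (by simp)).hasFDerivAt
  have hzero : ∀ v : ℝ × ℝ, P (v.1, v.2, fderiv ℝ f q v) = 0 := by
    have h1 : HasFDerivAt (fun r : ℝ × ℝ => ψ (r.1, r.2, f r)) _ q :=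
      HasFDerivAt.comp (g := ψ) q hψ.hasFDerivAt (hasFDerivAt_graph hfd)
    have h2 : (fun r : ℝ × ℝ => ψ (r.1, r.2, f r)) =ᶠ[𝓝 q] fun _ => 0 := by
      filter_upwards [h.2.2.2.2] with r hr
      exact sub_eq_zero.2 hr
    have h3 := h1.unique ((hasFDerivAt_const (0 : ℝ) q).congr_of_eventuallyEq h2)
    intro v
    exact DFunLike.congr_fun h3 v
  -- The constant is the `u`-derivative of `ψ`. Were it zero, `P` would vanish on the tangent plane
  -- and on the vertical direction, hence everywhere; but some vector is sent by the derivative of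
  -- `Φ` to `(0, 0, 1)`, where `ũ - g` has derivative one.
  refine ⟨P (0, 0, 1), fun hc => ?_, ?_⟩
  · have hPz : ∀ w, P w = 0 := fun w => by
      have hw : w = (w.1, w.2.1, fderiv ℝ f q (w.1, w.2.1)) +
          (w.2.2 - fderiv ℝ f q (w.1, w.2.1)) • ((0, 0, 1) : ℝ × ℝ × ℝ) := by
        ext <;> simp
      rw [hw, map_add, map_smul, hc, hzero (w.1, w.2.1)]; simp
    obtain ⟨w, hw⟩ := (hΦ.2.2 p hp).2 (0, 0, 1)
    have h1 := hPz w
    simp only [hP, ← hD] at h1 hw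
    have h0 : fderiv ℝ g q' (0, 0) = 0 := map_zero _
    simp [hw, pu, pr, h0] at h1
  · have hk : Tendsto (fun r : ℝ × ℝ => ((r.1, r.2, f₂ r), (r.1, r.2, f r))) (𝓝 q) (𝓝 (p, p)) := by
      have c1 := h.2.1.continuousAt
      have c2 := h₂.2.1.continuousAt
      have : ContinuousAt (fun r : ℝ × ℝ => ((r.1, r.2, f₂ r), (r.1, r.2, f r))) q := by fun_prop
      simpa [ContinuousAt, hval] using this
    have ho := hψ.isLittleO.comp_tendsto hk
    -- Both points over `r` move, so strict differentiability of `ψ` at `p` is what is used; they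
    -- differ only vertically, which makes the error `o(f₂ - f)`.
    have ho' : (fun r : ℝ × ℝ => ψ (r.1, r.2, f₂ r) - ψ (r.1, r.2, f r) - P (0, 0, 1) * (f₂ r - f r))
        =o[𝓝 q] fun r => f₂ r - f r := by
      refine (ho.congr_left fun r => ?_).trans_isBigO (IsBigO.of_bound 1 (Eventually.of_forall fun r => ?_))
      · have : ((r.1, r.2, f₂ r) - (r.1, r.2, f r) : ℝ × ℝ × ℝ) =
            (f₂ r - f r) • ((0, 0, 1) : ℝ × ℝ × ℝ) := by ext <;> simp
        simp only [Function.comp, this, map_smul, smul_eq_mul]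
        ring
      · simp [Prod.norm_def]
    refine ho'.congr' ?_ EventuallyEq.rfl
    filter_upwards [h.2.2.2.2, h₂.eventually_eq] with r h1 h2
    have e1 : ψ (r.1, r.2, f r) = 0 := sub_eq_zero.2 h1
    have e2 : ψ (r.1, r.2, f₂ r) = g₂ (Φ.base f₂ r) - g (Φ.base f₂ r) := by
      rw [h2]; rfl
    rw [e1, e2, sub_zero]

end LocalMap

/-- Two solutions of the equation with the same value at a point, and their images. -/
theorem Admissible.exists_perturbation {I : Set ℝ} {θ θ' : Coeffs} {Φ : LocalMap}
    (h : Admissible I θ Φ θ') {f f₂ : ℝ × ℝ → ℝ} {q : ℝ × ℝ}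
    (hq : (q.1, q.2, f q) ∈ Φ.dom) (hval : f₂ q = f q)
    (hf : ContDiffAt ℝ ∞ f q) (hf₂ : ContDiffAt ℝ ∞ f₂ q)
    (hs : θ.HoldsAt f q) (hs₂ : θ.HoldsAt f₂ q)
    (hinj : ∀ v, fderiv ℝ (Φ.base f) q v = 0 → v = 0)
    (hinj₂ : ∀ v, fderiv ℝ (Φ.base f₂) q v = 0 → v = 0) :
    ∃ (q' : ℝ × ℝ) (w : ℝ × ℝ → ℝ) (R : ℝ × ℝ → ℝ × ℝ) (c : ℝ), q' = Φ.base f q ∧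
      ContDiffAt ℝ ∞ w q' ∧ ContDiffAt ℝ ∞ R q' ∧ R q' = q ∧ (∀ᶠ s in 𝓝 q', Φ.base f₂ (R s) = s) ∧
      c ≠ 0 ∧ ((fun s => w s - c * (f₂ (R s) - f (R s))) =o[𝓝 q'] fun s => f₂ (R s) - f (R s)) ∧
      (Φ.base f =ᶠ[𝓝 q] Φ.base f₂ → ∀ᶠ r in 𝓝 q, w (Φ.base f r) =
        (Φ.toFun (r.1, r.2, f₂ r)).2.2 - (Φ.toFun (r.1, r.2, f r)).2.2) ∧
      deriv (fun t => w (t, q'.2)) q'.1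
        + θ'.α q'.1 * (Φ.toFun (q.1, q.2, f q)).2.2 * deriv (fun x => w (q'.1, x)) q'.2
        + θ'.β q'.1 * iteratedDeriv 3 (fun x => w (q'.1, x)) q'.2
        + θ'.σ q'.1 * iteratedDeriv 5 (fun x => w (q'.1, x)) q'.2 = 0 := by
  obtain ⟨hΦ, -, -, hiff⟩ := h
  have hq₂ : (q.1, q.2, f₂ q) ∈ Φ.dom := by rwa [hval]
  obtain ⟨g, -, hg, -⟩ := hΦ.exists_carriesGraph hf hq hinj
  -- The local inverse is taken along `f₂` because the comparison of the images is made at the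
  -- points `Φ.base f₂ r`.
  obtain ⟨g₂, R, hg₂, hR, hRq, hr⟩ := hΦ.exists_carriesGraph hf₂ hq₂ hinj₂
  have hb : Φ.base f₂ q = Φ.base f q := by simp [LocalMap.base, hval]
  rw [hb] at hg₂ hR hRq hr
  obtain ⟨c, hc, ho⟩ := hg.isLittleO_sub hΦ hg₂ hval
  have e1 : g (Φ.base f q) = (Φ.toFun (q.1, q.2, f q)).2.2 := hg.eventually_eq.self_of_nhds
  have e2 : g₂ (Φ.base f q) = (Φ.toFun (q.1, q.2, f q)).2.2 := by
    have := hg₂.eventually_eq.self_of_nhds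
    rwa [hb, hval] at this
  refine ⟨_, fun s => g₂ s - g s, R, c, rfl, hg₂.2.2.1.sub hg.2.2.1, hR, hRq, hr, hc, ?_, ?_, ?_⟩
  · have ht : Tendsto R (𝓝 (Φ.base f q)) (𝓝 q) := by
      have := hR.continuousAt.tendsto
      rwa [hRq] at this
    refine (ho.comp_tendsto ht).congr' ?_ EventuallyEq.rfl
    filter_upwards [hr] with s hs
    simp [Function.comp, hs]
  · intro hbb
    filter_upwards [hbb, hg.eventually_eq, hg₂.eventually_eq] with r h0 h1 h2
    rw [← h1, ← h2, ← h0]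
  · have := Coeffs.holdsAt_sub hg.2.2.1 hg₂.2.2.1 (e2.trans e1.symm)
      ((hiff _ _ _ _ hg).1 hs) ((hiff _ _ _ _ hg₂).1 hs₂)
    rwa [e1] at this

/-! ### The new time depends on the time only -/

namespace LocalMap

variable {Φ : LocalMap} {q : ℝ × ℝ}

theorem fderiv_apply (p w : ℝ × ℝ × ℝ) : fderiv ℝ Φ.toFun p w =
    w.1 • fderiv ℝ Φ.toFun p (1, 0, 0) + w.2.1 • fderiv ℝ Φ.toFun p (0, 1, 0)
      + w.2.2 • fderiv ℝ Φ.toFun p (0, 0, 1) := by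
  rw [← map_smul, ← map_smul, ← map_smul, ← map_add, ← map_add]
  congr 1
  ext <;> simp

/-- Total derivatives of the new independent variables along a graph with slopes `a` and `b`. -/
theorem IsPointTransformation.fderiv_base_jetPoly (hΦ : Φ.IsPointTransformation)
    {u a b c e d k : ℝ} (hq : (q.1, q.2, u) ∈ Φ.dom) (v : ℝ × ℝ) :
    fderiv ℝ (Φ.base (jetPoly q u a b c e d k)) q v =
      ((fderiv ℝ Φ.toFun (q.1, q.2, u) (v.1, v.2, a * v.1 + b * v.2)).1,
        (fderiv ℝ Φ.toFun (q.1, q.2, u) (v.1, v.2, a * v.1 + b * v.2)).2.1) := by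
  have h := hΦ.hasFDerivAt_base (hasFDerivAt_jetPoly q u a b c e d k) (by simpa using hq)
  rw [h.fderiv, jetPoly_self]
  simp [Prod.map]

end LocalMap

/-- Here `T1, T2, T3` and `X1, X2, X3` play the part of the partial derivatives of `t̃` and `x̃`,
and `a, b` of the slopes `u_t, u_x`. If no slopes worked, the product of the two expressions would
vanish as a polynomial in `a, b`. Its coefficients then make the second row a multiple of the first,
which contradicts the vector `w` on which the rows take the values `0` and `1`. -/
theorem exists_slopes {T1 T2 T3 X1 X2 X3 w1 w2 w3 : ℝ} (hT : T2 ≠ 0 ∨ T3 ≠ 0)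
    (h1 : T1 * w1 + T2 * w2 + T3 * w3 = 0) (h2 : X1 * w1 + X2 * w2 + X3 * w3 = 1) :
    ∃ a b : ℝ, T2 + T3 * b ≠ 0 ∧
      (T1 + T3 * a) * (X2 + X3 * b) - (T2 + T3 * b) * (X1 + X3 * a) ≠ 0 := by
  by_contra! hcon
  have key : ∀ a b : ℝ, (T2 + T3 * b) *
      ((T1 + T3 * a) * (X2 + X3 * b) - (T2 + T3 * b) * (X1 + X3 * a)) = 0 := by
    intro a b
    by_cases h : T2 + T3 * b = 0
    · simp [h]
    · simp [hcon a b h]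
  have k00 := key 0 0
  have k01 := key 0 1
  have k02 := key 0 (-1)
  have k10 := key 1 0
  have k11 := key 1 1
  have e1 : T2 * (T1 * X2 - T2 * X1) = 0 := by linear_combination k00
  have e2 : T3 * (T1 * X3 - T3 * X1) = 0 := by linear_combination (k01 + k02) / 2 - k00
  have e3 : T2 * (T1 * X3 - T3 * X1) + T3 * (T1 * X2 - T2 * X1) = 0 := by
    linear_combination (k01 - k02) / 2
  have e4 : T2 * (T3 * X2 - T2 * X3) = 0 := by linear_combination k10 - k00
  have e5 : T3 * (T3 * X2 - T2 * X3) = 0 := by linear_combination k11 - k01 - k10 + k00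
  rcases hT with h | h
  · have m1 := (mul_eq_zero.1 e1).resolve_left h
    have m3 := (mul_eq_zero.1 e4).resolve_left h
    have : T2 = 0 := by linear_combination (-T2) * h2 + X2 * h1 - w1 * m1 - w3 * m3
    exact h this
  · have m2 := (mul_eq_zero.1 e2).resolve_left h
    have m3 := (mul_eq_zero.1 e5).resolve_left h
    have : T3 = 0 := by linear_combination (-T3) * h2 + X3 * h1 - w1 * m2 + w2 * m3
    exact h this

theorem eq_zero_of_det_ne_zero {a b c d x y : ℝ} (h : a * d - b * c ≠ 0)
    (h1 : a * x + b * y = 0) (h2 : c * x + d * y = 0) : x = 0 ∧ y = 0 := by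
  constructor
  · exact (mul_eq_zero.1 (show (a * d - b * c) * x = 0 by linear_combination d * h1 - b * h2)).resolve_left h
  · exact (mul_eq_zero.1 (show (a * d - b * c) * y = 0 by linear_combination a * h2 - c * h1)).resolve_left h

/-- The determinant is the Jacobian `D_t t̃ D_x x̃ - D_x t̃ D_t x̃` of total derivatives along a
graph with slopes `a` and `b`. -/
theorem LocalMap.IsPointTransformation.fderiv_base_injective {Φ : LocalMap} {q : ℝ × ℝ}
    (hΦ : Φ.IsPointTransformation) {u a b c e d k : ℝ} (hq : (q.1, q.2, u) ∈ Φ.dom)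
    (hdet : ((fderiv ℝ Φ.toFun (q.1, q.2, u) (1, 0, 0)).1
        + (fderiv ℝ Φ.toFun (q.1, q.2, u) (0, 0, 1)).1 * a) *
      ((fderiv ℝ Φ.toFun (q.1, q.2, u) (0, 1, 0)).2.1
        + (fderiv ℝ Φ.toFun (q.1, q.2, u) (0, 0, 1)).2.1 * b) -
      ((fderiv ℝ Φ.toFun (q.1, q.2, u) (0, 1, 0)).1
        + (fderiv ℝ Φ.toFun (q.1, q.2, u) (0, 0, 1)).1 * b) *
      ((fderiv ℝ Φ.toFun (q.1, q.2, u) (1, 0, 0)).2.1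
        + (fderiv ℝ Φ.toFun (q.1, q.2, u) (0, 0, 1)).2.1 * a) ≠ 0) (v : ℝ × ℝ)
    (hv : fderiv ℝ (Φ.base (jetPoly q u a b c e d k)) q v = 0) : v = 0 := by
  rw [hΦ.fderiv_base_jetPoly hq, fderiv_apply] at hv
  simp only [Prod.mk_eq_zero, Prod.fst_add, Prod.snd_add, Prod.smul_fst, Prod.smul_snd,
    smul_eq_mul] at hv
  have := eq_zero_of_det_ne_zero hdet (x := v.1) (y := v.2)
    (by linear_combination hv.1) (by linear_combination hv.2)
  exact Prod.ext this.1 this.2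

theorem LocalMap.IsPointTransformation.fderiv_base_fderiv_inverse {Φ : LocalMap}
    (hΦ : Φ.IsPointTransformation) {f : ℝ × ℝ → ℝ} {q q' : ℝ × ℝ} {R : ℝ × ℝ → ℝ × ℝ}
    (hf : ContDiffAt ℝ ∞ f q) (hq : (q.1, q.2, f q) ∈ Φ.dom) (hR : ContDiffAt ℝ ∞ R q')
    (hRq : R q' = q) (hr : ∀ᶠ s in 𝓝 q', Φ.base f (R s) = s) (v : ℝ × ℝ) :
    fderiv ℝ (Φ.base f) q (fderiv ℝ R q' v) = v := by
  have hB : HasFDerivAt (Φ.base f) (fderiv ℝ (Φ.base f) q) (R q') := by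
    rw [hRq]
    exact ((hΦ.contDiffAt_base hf hq).differentiableAt (by simp)).hasFDerivAt
  have h1 := (hB.comp q' (hR.differentiableAt (by simp)).hasFDerivAt).unique
    ((hasFDerivAt_id q').congr_of_eventuallyEq hr)
  exact DFunLike.congr_fun h1 v

/-- The new time depends on the time only. -/
theorem Admissible.fderiv_time_eq_zero {I : Set ℝ} {θ θ' : Coeffs} {Φ : LocalMap}
    (h : Admissible I θ Φ θ') (hθ : θ.InClass I) {p : ℝ × ℝ × ℝ} (hp : p ∈ Φ.dom) :
    (fderiv ℝ Φ.toFun p (0, 1, 0)).1 = 0 ∧ (fderiv ℝ Φ.toFun p (0, 0, 1)).1 = 0 := by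
  by_contra hne
  obtain ⟨t, x, u⟩ := p
  set q : ℝ × ℝ := (t, x) with hqdef
  have hΦ := h.1
  have hσ : θ.σ q.1 ≠ 0 := (hθ.2 t (h.2.1 ⟨_, hp, rfl⟩)).2.2
  have hσ' : θ'.σ (Φ.toFun (t, x, u)).1 ≠ 0 := (h.2.2.1.2 _ ⟨_, ⟨_, hp, rfl⟩, rfl⟩).2.2
  obtain ⟨w, hw⟩ := (hΦ.2.2 _ hp).2 (0, 1, 0)
  rw [LocalMap.fderiv_apply] at hw
  -- If `t̃` involves `x` or `u`, some slopes make `D_x t̃` nonzero while the graph still has a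
  -- graph as its image.
  obtain ⟨a, b, hTb, hdet⟩ := exists_slopes (by tauto)
    (T1 := (fderiv ℝ Φ.toFun (t, x, u) (1, 0, 0)).1) (X1 := (fderiv ℝ Φ.toFun (t, x, u) (1, 0, 0)).2.1)
    (X2 := (fderiv ℝ Φ.toFun (t, x, u) (0, 1, 0)).2.1) (X3 := (fderiv ℝ Φ.toFun (t, x, u) (0, 0, 1)).2.1)
    (T2 := (fderiv ℝ Φ.toFun (t, x, u) (0, 1, 0)).1) (T3 := (fderiv ℝ Φ.toFun (t, x, u) (0, 0, 1)).1)
    (w1 := w.1) (w2 := w.2.1) (w3 := w.2.2)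
    (by have := congrArg Prod.fst hw; simp at this; linear_combination this)
    (by have := congrArg (fun z => z.2.1) hw; simp at this; linear_combination this)
  set d : ℝ := -(a + θ.α q.1 * u * b) / (θ.σ q.1 * 120) with hd
  have hd' : a + θ.α q.1 * u * b + θ.β q.1 * (6 * 0) + θ.σ q.1 * (120 * d) = 0 := by
    rw [hd]; field_simp; ring
  -- The two functions differ by `(t - t₀)^5`. The old equation does not see this change, but when
  -- the old time varies with `x̃` it produces a fifth `x̃`-derivative of the image.
  obtain ⟨q', w, R, c, hq', hw, hR, hRq, hr, hc, ho, -, heq⟩ := h.exists_perturbation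
    (f := jetPoly q u a b 0 0 d 0) (f₂ := jetPoly q u a b 0 0 d 1) (q := q) (by simpa using hp)
    (by simp) (contDiff_jetPoly _ _ _ _ _ _ _ _).contDiffAt (contDiff_jetPoly _ _ _ _ _ _ _ _).contDiffAt
    ((θ.holdsAt_jetPoly _ _ _ _ _ _ _ _).2 hd') ((θ.holdsAt_jetPoly _ _ _ _ _ _ _ _).2 hd')
    (hΦ.fderiv_base_injective hp hdet) (hΦ.fderiv_base_injective hp hdet)
  have hdiff : ∀ r, jetPoly q u a b 0 0 d 1 r - jetPoly q u a b 0 0 d 0 r = (r.1 - q.1) ^ 5 := by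
    intro r; simp only [jetPoly]; ring
  simp only [hdiff] at ho
  have hq1 : q'.1 = (Φ.toFun (t, x, u)).1 := by rw [hq']; simp [LocalMap.base, hqdef]
  -- the derivative of the local inverse
  have hRd := (hR.differentiableAt (by simp)).hasFDerivAt
  have hsp : HasDerivAt (fun y => (q'.1, y)) ((0, 1) : ℝ × ℝ) q'.2 :=
    (hasDerivAt_const _ _).prodMk (hasDerivAt_id _)
  have htm : HasDerivAt (fun y => (y, q'.2)) ((1, 0) : ℝ × ℝ) q'.1 :=
    (hasDerivAt_id _).prodMk (hasDerivAt_const _ _)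
  have hτ : HasDerivAt (fun y => (R (q'.1, y)).1) (fderiv ℝ R q' (0, 1)).1 q'.2 :=
    (HasFDerivAt.comp_hasDerivAt (l := R) q'.2 hRd hsp).fst
  have hτ' : HasDerivAt (fun y => (R (y, q'.2)).1) (fderiv ℝ R q' (1, 0)).1 q'.1 :=
    (HasFDerivAt.comp_hasDerivAt (l := R) q'.1 hRd htm).fst
  -- If `∂t/∂x̃` vanished, then `D_x t̃ ≠ 0` would force `∂x/∂x̃ = 0` as well, and the inverse would
  -- be degenerate.
  have hM : (fderiv ℝ R q' (0, 1)).1 ≠ 0 := by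
    intro hM0
    have h2 := hΦ.fderiv_base_fderiv_inverse (contDiff_jetPoly _ _ _ _ _ _ _ _).contDiffAt
      (by simpa using hp) hR hRq hr (0, 1)
    rw [hΦ.fderiv_base_jetPoly hp, LocalMap.fderiv_apply, hM0] at h2
    have h3 := congrArg Prod.fst h2
    have h4 := congrArg Prod.snd h2
    simp at h3 h4
    have h5 : (fderiv ℝ R q' (0, 1)).2 = 0 :=
      (mul_eq_zero.1 (show _ * _ = (0 : ℝ) by linear_combination h3)).resolve_left hTb
    simp [h5] at h4
  have cx : Tendsto (fun y => (q'.1, y)) (𝓝 q'.2) (𝓝 q') := by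
    simpa using hsp.continuousAt.tendsto
  have ct : Tendsto (fun y => (y, q'.2)) (𝓝 q'.1) (𝓝 q') := by
    simpa using htm.continuousAt.tendsto
  have hR1 : (R (q'.1, q'.2)).1 = q.1 := by simp [hRq]
  obtain ⟨d1, d3, d5⟩ := derivs_of_perturbation (φ := fun y => w (q'.1, y)) (c := c)
    (ContDiffAt.comp (g := w) q'.2 hw (by fun_prop)) hτ
    (by simpa [Function.comp_def, hR1] using ho.comp_tendsto cx)
  -- A fifth power contributes nothing to the first derivative in the new time, so only `120 c σ̃
  -- M^5 = 0` remains, which is absurd.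
  have dt := hasDerivAt_of_isLittleO_sub (φ := fun y => w (y, q'.2))
    (η := fun y => ((R (y, q'.2)).1 - q.1) ^ 5) (c := c)
    ((hτ'.sub_const q.1).pow 5) (by simp [hRq]) (by simpa [Function.comp_def] using ho.comp_tendsto ct)
  rw [dt.deriv, d1, d3, d5] at heq
  rw [hR1, hq1] at heq
  simp [hσ', hc, hM] at heq

namespace LocalMap

variable {Φ : LocalMap}

theorem isOpen_times (Φ : LocalMap) : IsOpen Φ.times := isOpenMap_fst _ Φ.isOpen_dom

theorem ordConnected_times (Φ : LocalMap) : Φ.times.OrdConnected :=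
  (Φ.isConnected_dom.isPreconnected.image _ continuous_fst.continuousOn).ordConnected

/-- A function whose derivatives in `x` and `u` vanish depends on the time only. -/
theorem eq_of_fderiv_eq_zero {K : ℝ × ℝ × ℝ → ℝ} (hK : ∀ p ∈ Φ.dom, DifferentiableAt ℝ K p)
    (h1 : ∀ p ∈ Φ.dom, fderiv ℝ K p (0, 1, 0) = 0) (h2 : ∀ p ∈ Φ.dom, fderiv ℝ K p (0, 0, 1) = 0)
    {t : ℝ} {y z : ℝ × ℝ} (hy : (t, y) ∈ Φ.dom) (hz : (t, z) ∈ Φ.dom) : K (t, y) = K (t, z) := by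
  have hd : ∀ y : ℝ × ℝ, (t, y) ∈ Φ.dom → HasFDerivAt (fun y => K (t, y))
      ((fderiv ℝ K (t, y)).comp ((0 : ℝ × ℝ →L[ℝ] ℝ).prod (ContinuousLinearMap.id ℝ _))) y :=
    fun y hy => (hK _ hy).hasFDerivAt.comp y ((hasFDerivAt_const t y).prodMk (hasFDerivAt_id y))
  refine IsOpen.is_const_of_fderiv_eq_zero (𝕜 := ℝ) (f := fun y => K (t, y)) (s := {y | (t, y) ∈ Φ.dom})
    (Φ.isOpen_dom.preimage (by fun_prop)) (Φ.isPreconnected_slice t)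
    (fun y hy => (hd y hy).differentiableAt.differentiableWithinAt) (fun y hy => ?_) hy hz
  rw [(hd y hy).fderiv]
  ext <;> simp
  · exact h1 _ hy
  · exact h2 _ hy

/-- A smooth function that is constant on the time slices is a smooth function of the time. -/
theorem exists_eq_comp_fst {K : ℝ × ℝ × ℝ → ℝ} (hK : ContDiffOn ℝ ∞ K Φ.dom)
    (h : ∀ (t : ℝ) (y z : ℝ × ℝ), (t, y) ∈ Φ.dom → (t, z) ∈ Φ.dom → K (t, y) = K (t, z)) :
    ∃ k : ℝ → ℝ, ContDiffOn ℝ ∞ k Φ.times ∧ ∀ t y, (t, y) ∈ Φ.dom → K (t, y) = k t := by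
  classical
  let k : ℝ → ℝ := fun t => if ht : ∃ y, (t, y) ∈ Φ.dom then K (t, ht.choose) else 0
  have hk : ∀ t y, (t, y) ∈ Φ.dom → K (t, y) = k t := by
    intro t y hy
    have ht : ∃ y, (t, y) ∈ Φ.dom := ⟨y, hy⟩
    simp only [k, dif_pos ht]
    exact h t _ _ hy ht.choose_spec
  refine ⟨k, ?_, hk⟩
  rintro _ ⟨⟨t, y⟩, hp, rfl⟩
  refine ContDiffAt.contDiffWithinAt ?_
  have hc : ContDiffAt ℝ ∞ (fun s : ℝ => K (s, y)) t :=
    (hK.contDiffAt (Φ.isOpen_dom.mem_nhds hp)).comp (g := K) t (by fun_prop)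
  refine hc.congr_of_eventuallyEq ?_
  have : ∀ᶠ s in 𝓝 t, (s, y) ∈ Φ.dom :=
    (Φ.isOpen_dom.preimage (by fun_prop : Continuous fun s : ℝ => (s, y))).mem_nhds hp
  filter_upwards [this] with s hs using (hk s y hs).symm

theorem IsPointTransformation.fderiv_fst (hΦ : Φ.IsPointTransformation) {p : ℝ × ℝ × ℝ}
    (hp : p ∈ Φ.dom) (v : ℝ × ℝ × ℝ) :
    fderiv ℝ (fun z => (Φ.toFun z).1) p v = (fderiv ℝ Φ.toFun p v).1 := by
  rw [(hΦ.hasFDerivAt hp).fst.fderiv]; rfl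

end LocalMap

/-- The new time is a function of the time with nonvanishing derivative. -/
theorem Admissible.exists_time {I : Set ℝ} {θ θ' : Coeffs} {Φ : LocalMap}
    (h : Admissible I θ Φ θ') (hθ : θ.InClass I) :
    ∃ T : ℝ → ℝ, ContDiffOn ℝ ∞ T Φ.times ∧ (∀ t ∈ Φ.times, deriv T t ≠ 0) ∧
      ∀ p ∈ Φ.dom, (Φ.toFun p).1 = T p.1 ∧ (fderiv ℝ Φ.toFun p (1, 0, 0)).1 = deriv T p.1 := by
  have hΦ := h.1
  have hK : ContDiffOn ℝ ∞ (fun z => (Φ.toFun z).1) Φ.dom := contDiff_fst.comp_contDiffOn hΦ.1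
  obtain ⟨T, hT, hTe⟩ := LocalMap.exists_eq_comp_fst hK fun t y z hy hz =>
    LocalMap.eq_of_fderiv_eq_zero
      (fun p hp => ((hK.contDiffAt (Φ.isOpen_dom.mem_nhds hp)).differentiableAt (by simp)))
      (fun p hp => by rw [hΦ.fderiv_fst hp]; exact (h.fderiv_time_eq_zero hθ hp).1)
      (fun p hp => by rw [hΦ.fderiv_fst hp]; exact (h.fderiv_time_eq_zero hθ hp).2) hy hz
  have hd : ∀ p ∈ Φ.dom, (fderiv ℝ Φ.toFun p (1, 0, 0)).1 = deriv T p.1 := by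
    intro p hp
    have hTd : DifferentiableAt ℝ T p.1 :=
      (hT.contDiffAt (Φ.isOpen_times.mem_nhds ⟨p, hp, rfl⟩)).differentiableAt (by simp)
    have h0 : HasFDerivAt (fun z : ℝ × ℝ × ℝ => T z.1)
        (deriv T p.1 • ContinuousLinearMap.fst ℝ ℝ (ℝ × ℝ)) p :=
      hTd.hasDerivAt.comp_hasFDerivAt p hasFDerivAt_fst
    have h1 : HasFDerivAt (fun z => (Φ.toFun z).1) _ p := h0.congr_of_eventuallyEq (by
        filter_upwards [Φ.isOpen_dom.mem_nhds hp] with z hz using hTe z.1 z.2 hz)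
    rw [← hΦ.fderiv_fst hp, h1.fderiv]
    simp
  refine ⟨T, hT, ?_, fun p hp => ⟨hTe _ _ hp, hd p hp⟩⟩
  rintro _ ⟨p, hp, rfl⟩ h0
  obtain ⟨w, hw⟩ := (hΦ.2.2 p hp).2 (1, 0, 0)
  rw [LocalMap.fderiv_apply] at hw
  have := congrArg Prod.fst hw
  simp [hd p hp, h.fderiv_time_eq_zero hθ hp, h0] at this

/-! ### The new space variable is affine in `x` -/

/-- Comparison of the terms of the highest order. -/
theorem Admissible.fifth_order {I : Set ℝ} {θ θ' : Coeffs} {Φ : LocalMap}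
    (h : Admissible I θ Φ θ') (hθ : θ.InClass I) {p : ℝ × ℝ × ℝ} (hp : p ∈ Φ.dom) (b : ℝ)
    (hb : (fderiv ℝ Φ.toFun p (0, 1, 0)).2.1 + (fderiv ℝ Φ.toFun p (0, 0, 1)).2.1 * b ≠ 0) :
    θ.σ p.1 * ((fderiv ℝ Φ.toFun p (0, 1, 0)).2.1 + (fderiv ℝ Φ.toFun p (0, 0, 1)).2.1 * b) ^ 5 =
      (fderiv ℝ Φ.toFun p (1, 0, 0)).1 * θ'.σ (Φ.toFun p).1 := by
  obtain ⟨T, hT, hT0, hTe⟩ := h.exists_time hθ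
  have hTinj := injOn_of_deriv_ne_zero Φ.ordConnected_times hT0
  obtain ⟨hd1, hd2⟩ := h.fderiv_time_eq_zero hθ hp
  have hd0 : (fderiv ℝ Φ.toFun p (1, 0, 0)).1 ≠ 0 := by
    rw [(hTe p hp).2]; exact hT0 _ ⟨p, hp, rfl⟩
  obtain ⟨t, x, u⟩ := p
  set q : ℝ × ℝ := (t, x) with hqdef
  have hΦ := h.1
  have hdet : ∀ a : ℝ, ((fderiv ℝ Φ.toFun (q.1, q.2, u) (1, 0, 0)).1
        + (fderiv ℝ Φ.toFun (q.1, q.2, u) (0, 0, 1)).1 * a) *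
      ((fderiv ℝ Φ.toFun (q.1, q.2, u) (0, 1, 0)).2.1
        + (fderiv ℝ Φ.toFun (q.1, q.2, u) (0, 0, 1)).2.1 * b) -
      ((fderiv ℝ Φ.toFun (q.1, q.2, u) (0, 1, 0)).1
        + (fderiv ℝ Φ.toFun (q.1, q.2, u) (0, 0, 1)).1 * b) *
      ((fderiv ℝ Φ.toFun (q.1, q.2, u) (1, 0, 0)).2.1
        + (fderiv ℝ Φ.toFun (q.1, q.2, u) (0, 0, 1)).2.1 * a) ≠ 0 := by
    intro a
    simp only [hqdef, hd1, hd2]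
    simpa using ⟨hd0, hb⟩
  -- The perturbation is `(x - x₀)^5 - 120 σ (t - t₀)`: its time derivative balances the fifth
  -- derivative `120` in the equation.
  obtain ⟨q', w, R, c, hq', hw, hR, hRq, hr, hc, ho, -, heq⟩ := h.exists_perturbation
    (f := jetPoly q u (-(θ.α q.1 * u * b)) b 0 0 0 0)
    (f₂ := jetPoly q u (-(θ.α q.1 * u * b) - 120 * θ.σ q.1) b 0 0 1 0) (q := q) (by simpa using hp)
    (by simp) (contDiff_jetPoly _ _ _ _ _ _ _ _).contDiffAt (contDiff_jetPoly _ _ _ _ _ _ _ _).contDiffAt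
    ((θ.holdsAt_jetPoly _ _ _ _ _ _ _ _).2 (by ring)) ((θ.holdsAt_jetPoly _ _ _ _ _ _ _ _).2 (by ring))
    (hΦ.fderiv_base_injective hp (hdet _)) (hΦ.fderiv_base_injective hp (hdet _))
  have hdiff : ∀ r, jetPoly q u (-(θ.α q.1 * u * b) - 120 * θ.σ q.1) b 0 0 1 0 r
      - jetPoly q u (-(θ.α q.1 * u * b)) b 0 0 0 0 r
      = (r.2 - q.2) ^ 5 - 120 * θ.σ q.1 * (r.1 - q.1) := by
    intro r; simp only [jetPoly]; ring
  simp only [hdiff] at ho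
  have hq1 : q'.1 = (Φ.toFun (t, x, u)).1 := by rw [hq']; simp [LocalMap.base, hqdef]
  have hRd := (hR.differentiableAt (by simp)).hasFDerivAt
  have hsp : HasDerivAt (fun y => (q'.1, y)) ((0, 1) : ℝ × ℝ) q'.2 :=
    (hasDerivAt_const _ _).prodMk (hasDerivAt_id _)
  have htm : HasDerivAt (fun y => (y, q'.2)) ((1, 0) : ℝ × ℝ) q'.1 :=
    (hasDerivAt_id _).prodMk (hasDerivAt_const _ _)
  have hξ : HasDerivAt (fun y => (R (q'.1, y)).2) (fderiv ℝ R q' (0, 1)).2 q'.2 :=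
    (HasFDerivAt.comp_hasDerivAt (l := R) q'.2 hRd hsp).snd
  have hRt := HasFDerivAt.comp_hasDerivAt (l := R) q'.1 hRd htm
  have hξ' : HasDerivAt (fun y => (R (y, q'.2)).2) (fderiv ℝ R q' (1, 0)).2 q'.1 := hRt.snd
  have hτ' : HasDerivAt (fun y => (R (y, q'.2)).1) (fderiv ℝ R q' (1, 0)).1 q'.1 := hRt.fst
  have hinv := hΦ.fderiv_base_fderiv_inverse (contDiff_jetPoly q u _ _ _ _ _ _).contDiffAt
      (by simpa using hp) hR hRq hr
  have hm : (fderiv ℝ Φ.toFun (t, x, u) (1, 0, 0)).1 * (fderiv ℝ R q' (1, 0)).1 = 1 := by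
    have h2 := hinv (1, 0)
    rw [hΦ.fderiv_base_jetPoly hp, LocalMap.fderiv_apply] at h2
    have h3 := congrArg Prod.fst h2
    simp [hqdef, hd1, hd2] at h3
    linear_combination h3
  have hM : ((fderiv ℝ Φ.toFun (t, x, u) (0, 1, 0)).2.1
      + (fderiv ℝ Φ.toFun (t, x, u) (0, 0, 1)).2.1 * b) * (fderiv ℝ R q' (0, 1)).2 = 1 := by
    have h2 := hinv (0, 1)
    rw [hΦ.fderiv_base_jetPoly hp, LocalMap.fderiv_apply] at h2
    have h3 := congrArg Prod.fst h2
    have h4 := congrArg Prod.snd h2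
    simp [hqdef, hd1, hd2, hd0] at h3 h4
    simp [h3] at h4
    linear_combination h4
  have cx : Tendsto (fun y => (q'.1, y)) (𝓝 q'.2) (𝓝 q') := by
    simpa using hsp.continuousAt.tendsto
  have ct : Tendsto (fun y => (y, q'.2)) (𝓝 q'.1) (𝓝 q') := by
    simpa using htm.continuousAt.tendsto
  have hR2 : (R (q'.1, q'.2)).2 = q.2 := by simp [hRq]
  have hdom : ∀ᶠ s in 𝓝 q', ((R s).1, (R s).2,
      jetPoly q u (-(θ.α q.1 * u * b) - 120 * θ.σ q.1) b 0 0 1 0 (R s)) ∈ Φ.dom := by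
    have hcont : ContinuousAt (fun s => ((R s).1, (R s).2,
        jetPoly q u (-(θ.α q.1 * u * b) - 120 * θ.σ q.1) b 0 0 1 0 (R s))) q' := by
      have h1 := hR.continuousAt
      have h2 : ContinuousAt (fun s =>
        jetPoly q u (-(θ.α q.1 * u * b) - 120 * θ.σ q.1) b 0 0 1 0 (R s)) q' :=
        ((contDiff_jetPoly q u _ b 0 0 1 0).continuous.continuousAt).comp h1
      fun_prop
    refine hcont.eventually_mem (Φ.isOpen_dom.mem_nhds ?_)
    simpa [hRq] using hp
  -- At a fixed new time the old time is fixed too, by injectivity of `T`. Along `x̃` only the fifth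
  -- power is therefore seen, and the term linear in `t` drops out.
  have hfix : ∀ᶠ y in 𝓝 q'.2, (R (q'.1, y)).1 = q.1 := by
    filter_upwards [cx.eventually hdom, cx.eventually hr] with y h1 h2
    refine hTinj ⟨_, h1, rfl⟩ ⟨_, hp, rfl⟩ ?_
    rw [← (hTe _ hp).1, ← hq1, ← (hTe _ h1).1]
    exact congrArg Prod.fst h2
  obtain ⟨d1, d3, d5⟩ := derivs_of_perturbation (φ := fun y => w (q'.1, y)) (c := c)
    (ContDiffAt.comp (g := w) q'.2 hw (by fun_prop)) hξ
    ((ho.comp_tendsto cx).congr'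
      (by filter_upwards [hfix] with y hy; simp [hR2, hy])
      (by filter_upwards [hfix] with y hy; simp [hR2, hy]))
  have dt := hasDerivAt_of_isLittleO_sub (φ := fun y => w (y, q'.2))
    (η := fun y => ((R (y, q'.2)).2 - q.2) ^ 5 - 120 * θ.σ q.1 * ((R (y, q'.2)).1 - q.1)) (c := c)
    (((hξ'.sub_const q.2).pow 5).sub ((hτ'.sub_const q.1).const_mul _)) (by simp [hRq])
    (by simpa [Function.comp_def] using ho.comp_tendsto ct)
  rw [dt.deriv, d1, d3, d5, hR2, hq1] at heq
  simp at heq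
  set ξ := (fderiv ℝ Φ.toFun (t, x, u) (0, 1, 0)).2.1
      + (fderiv ℝ Φ.toFun (t, x, u) (0, 0, 1)).2.1 * b
  set M := (fderiv ℝ R q' (0, 1)).2
  set m := (fderiv ℝ R q' (1, 0)).1
  have hξM : ξ ^ 5 * M ^ 5 = 1 := by rw [← mul_pow, hM, one_pow]
  -- Here `M = ∂x/∂x̃` and `m = ∂t/∂t̃`; the linear equation reduces to `120 c (σ̃ M^5 - σ m) = 0`.
  have e : θ'.σ (Φ.toFun (t, x, u)).1 * M ^ 5 = θ.σ t * m := by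
    refine mul_left_cancel₀ (mul_ne_zero (by norm_num : (120 : ℝ) ≠ 0) hc) ?_
    linear_combination heq
  linear_combination (fderiv ℝ Φ.toFun (t, x, u) (1, 0, 0)).1 * (θ'.σ (Φ.toFun (t, x, u)).1 * hξM
    - ξ ^ 5 * e) - θ.σ t * ξ ^ 5 * hm

/-- In the fifth order relation the right side does not involve the slope `b`, while the left side
is a fifth power of an expression affine in `b`; so the coefficient of `b` is zero. If `x̃_x`
vanished as well, the rows of `t̃` and `x̃` in the Jacobian matrix would be proportional. -/
theorem Admissible.fderiv_space {I : Set ℝ} {θ θ' : Coeffs} {Φ : LocalMap}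
    (h : Admissible I θ Φ θ') (hθ : θ.InClass I) {p : ℝ × ℝ × ℝ} (hp : p ∈ Φ.dom) :
    (fderiv ℝ Φ.toFun p (0, 0, 1)).2.1 = 0 ∧ (fderiv ℝ Φ.toFun p (0, 1, 0)).2.1 ≠ 0 := by
  have h1 := h.fifth_order hθ hp
  have hσ : θ.σ p.1 ≠ 0 := (hθ.2 _ (h.2.1 ⟨_, hp, rfl⟩)).2.2
  set X2 := (fderiv ℝ Φ.toFun p (0, 1, 0)).2.1 with hX2
  set X3 := (fderiv ℝ Φ.toFun p (0, 0, 1)).2.1 with hX3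
  have h3 : X3 = 0 := by
    by_contra h3
    -- The slopes are chosen so that the affine expression takes the values `1` and `2`; then `2^5 -
    -- 1 = 31`.
    have e1 : X2 + X3 * ((1 - X2) / X3) = 1 := by field_simp; ring
    have e2 : X2 + X3 * ((2 - X2) / X3) = 2 := by field_simp; ring
    have k1 := h1 ((1 - X2) / X3) (by rw [e1]; norm_num)
    have k2 := h1 ((2 - X2) / X3) (by rw [e2]; norm_num)
    rw [e1] at k1
    rw [e2] at k2
    have : θ.σ p.1 * 31 = 0 := by linear_combination k2 - k1
    simp [hσ] at this
  refine ⟨h3, fun h2 => ?_⟩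
  obtain ⟨w, hw⟩ := (h.1.2.2 p hp).2 (0, 1, 0)
  rw [LocalMap.fderiv_apply] at hw
  have e1 := congrArg Prod.fst hw
  have e2 := congrArg (fun z => z.2.1) hw
  obtain ⟨d1, d2⟩ := h.fderiv_time_eq_zero hθ hp
  obtain ⟨T, hT, hT0, hTe⟩ := h.exists_time hθ
  have hd0 : (fderiv ℝ Φ.toFun p (1, 0, 0)).1 ≠ 0 := by
    rw [(hTe p hp).2]; exact hT0 _ ⟨p, hp, rfl⟩
  simp [d1, d2, hd0] at e1
  simp [← hX2, ← hX3, h2, h3, e1] at e2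

/-- The new space variable is affine in `x`, with coefficients that depend on the time only. -/
theorem Admissible.exists_affine_base {I : Set ℝ} {θ θ' : Coeffs} {Φ : LocalMap}
    (h : Admissible I θ Φ θ') (hθ : θ.InClass I) :
    ∃ T X Y : ℝ → ℝ, ContDiffOn ℝ ∞ T Φ.times ∧ ContDiffOn ℝ ∞ X Φ.times ∧
      ContDiffOn ℝ ∞ Y Φ.times ∧ (∀ t ∈ Φ.times, deriv T t ≠ 0) ∧ (∀ t ∈ Φ.times, X t ≠ 0) ∧
      (∀ t x u, (t, x, u) ∈ Φ.dom → (Φ.toFun (t, x, u)).1 = T t ∧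
        (Φ.toFun (t, x, u)).2.1 = X t * x + Y t) ∧
      ∀ t ∈ Φ.times, θ.σ t * X t ^ 5 = deriv T t * θ'.σ (T t) := by
  have hΦ := h.1
  obtain ⟨T, hT, hT0, hTe⟩ := h.exists_time hθ
  have hσ : ∀ p ∈ Φ.dom, θ.σ p.1 ≠ 0 := fun p hp => (hθ.2 _ (h.2.1 ⟨_, hp, rfl⟩)).2.2
  have h5 : ∀ p ∈ Φ.dom, θ.σ p.1 * (fderiv ℝ Φ.toFun p (0, 1, 0)).2.1 ^ 5 =
      deriv T p.1 * θ'.σ (T p.1) := by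
    intro p hp
    have := h.fifth_order hθ hp 0 (by simpa using (h.fderiv_space hθ hp).2)
    simpa [(hTe p hp).2, (hTe p hp).1] using this
  have hD : ContDiffOn ℝ ∞ (fderiv ℝ Φ.toFun) Φ.dom := hΦ.1.fderiv_of_isOpen Φ.isOpen_dom (by simp)
  have hK : ContDiffOn ℝ ∞ (fun p => (fderiv ℝ Φ.toFun p (0, 1, 0)).2.1) Φ.dom := by
    have := hD.clm_apply (contDiffOn_const (c := ((0, 1, 0) : ℝ × ℝ × ℝ)))
    fun_prop
  obtain ⟨X, hX, hXe⟩ := LocalMap.exists_eq_comp_fst hK fun t y z hy hz => by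
    -- The relation determines `x̃_x` from `t` alone, since the fifth power is injective on the
    -- reals.
    refine (Odd.strictMono_pow (⟨2, by norm_num⟩ : Odd 5)).injective ?_
    refine mul_left_cancel₀ (hσ _ hy) ?_
    exact (h5 _ hy).trans (h5 _ hz).symm
  have hXp : ∀ p ∈ Φ.dom, (fderiv ℝ Φ.toFun p (0, 1, 0)).2.1 = X p.1 := fun p hp => hXe p.1 p.2 hp
  have hK0 : ContDiffOn ℝ ∞ (fun p => (Φ.toFun p).2.1 - X p.1 * p.2.1) Φ.dom := by
    have h1 : ContDiffOn ℝ ∞ (fun p : ℝ × ℝ × ℝ => X p.1) Φ.dom :=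
      hX.comp contDiff_fst.contDiffOn fun p hp => ⟨p, hp, rfl⟩
    exact (contDiff_fst.comp_contDiffOn (contDiff_snd.comp_contDiffOn hΦ.1)).sub
      (h1.mul (by fun_prop))
  have hdX : ∀ p ∈ Φ.dom, ∀ v, fderiv ℝ (fun p => (Φ.toFun p).2.1 - X p.1 * p.2.1) p v =
      (fderiv ℝ Φ.toFun p v).2.1 - (X p.1 * v.2.1 + p.2.1 * (deriv X p.1 * v.1)) := by
    intro p hp v
    have hXd : DifferentiableAt ℝ X p.1 :=
      (hX.contDiffAt (Φ.isOpen_times.mem_nhds ⟨p, hp, rfl⟩)).differentiableAt (by simp)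
    have h0 : HasFDerivAt (fun z : ℝ × ℝ × ℝ => X z.1)
        (deriv X p.1 • ContinuousLinearMap.fst ℝ ℝ (ℝ × ℝ)) p :=
      hXd.hasDerivAt.comp_hasFDerivAt p hasFDerivAt_fst
    have h1 : HasFDerivAt (fun z : ℝ × ℝ × ℝ => z.2.1)
        ((ContinuousLinearMap.fst ℝ ℝ ℝ).comp (ContinuousLinearMap.snd ℝ ℝ (ℝ × ℝ))) p :=
      hasFDerivAt_snd.fst
    have h2 : HasFDerivAt (fun p => (Φ.toFun p).2.1 - X p.1 * p.2.1) _ p :=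
      (hΦ.hasFDerivAt hp).snd.fst.sub (h0.mul h1)
    rw [h2.fderiv]
    simp
  obtain ⟨Y, hY, hYe⟩ := LocalMap.exists_eq_comp_fst hK0 fun t y z hy hz =>
    LocalMap.eq_of_fderiv_eq_zero
      (fun p hp => ((hK0.contDiffAt (Φ.isOpen_dom.mem_nhds hp)).differentiableAt (by simp)))
      (fun p hp => by rw [hdX p hp, hXp p hp]; simp)
      (fun p hp => by rw [hdX p hp, (h.fderiv_space hθ hp).1]; simp) hy hz
  refine ⟨T, X, Y, hT, hX, hY, hT0, ?_, ?_, ?_⟩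
  · rintro _ ⟨p, hp, rfl⟩
    rw [← hXp p hp]
    exact (h.fderiv_space hθ hp).2
  · intro t x u hp
    exact ⟨(hTe _ hp).1, by linear_combination hYe t (x, u) hp⟩
  · rintro _ ⟨p, hp, rfl⟩
    rw [← hXp p hp]
    exact h5 p hp

/-! ### The equation in the old independent variables -/

/-- Derivatives of the composition with `(t, x) ↦ (T(t), X(t) x + Y(t))`. -/
theorem derivs_comp_affine_base {T X Y : ℝ → ℝ} {T' X' Y' : ℝ} {q : ℝ × ℝ} {w k : ℝ × ℝ → ℝ}
    (hT : HasDerivAt T T' q.1) (hX : HasDerivAt X X' q.1) (hY : HasDerivAt Y Y' q.1)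
    (hw : ContDiffAt ℝ ∞ w (T q.1, X q.1 * q.2 + Y q.1))
    (hk : ∀ᶠ r in 𝓝 q, k r = w (T r.1, X r.1 * r.2 + Y r.1)) :
    HasDerivAt (fun t => k (t, q.2))
      (T' * deriv (fun t => w (t, X q.1 * q.2 + Y q.1)) (T q.1) +
        (X' * q.2 + Y') * deriv (fun x => w (T q.1, x)) (X q.1 * q.2 + Y q.1)) q.1 ∧
    ∀ n, iteratedDeriv n (fun x => k (q.1, x)) q.2 =
      X q.1 ^ n * iteratedDeriv n (fun x => w (T q.1, x)) (X q.1 * q.2 + Y q.1) := by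
  have hwd := (hw.differentiableAt (by simp)).hasFDerivAt
  set L := fderiv ℝ w (T q.1, X q.1 * q.2 + Y q.1)
  constructor
  · have h1 : HasDerivAt (fun t => w (T t, X t * q.2 + Y t)) _ q.1 :=
      HasFDerivAt.comp_hasDerivAt (l := w) q.1 hwd (hT.prodMk ((hX.mul_const q.2).add hY))
    have h2 : HasDerivAt (fun t => w (t, X q.1 * q.2 + Y q.1)) (L (1, 0)) (T q.1) :=
      HasFDerivAt.comp_hasDerivAt (l := w) _ hwd ((hasDerivAt_id _).prodMk (hasDerivAt_const _ _))
    have h3 : HasDerivAt (fun x => w (T q.1, x)) (L (0, 1)) (X q.1 * q.2 + Y q.1) :=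
      HasFDerivAt.comp_hasDerivAt (l := w) _ hwd ((hasDerivAt_const _ _).prodMk (hasDerivAt_id _))
    rw [h2.deriv, h3.deriv]
    have h4 : L (T', X' * q.2 + Y') = T' * L (1, 0) + (X' * q.2 + Y') * L (0, 1) := by
      have : ((T', X' * q.2 + Y') : ℝ × ℝ) =
          T' • ((1, 0) : ℝ × ℝ) + (X' * q.2 + Y') • ((0, 1) : ℝ × ℝ) := by ext <;> simp
      rw [this, map_add, map_smul, map_smul, smul_eq_mul, smul_eq_mul]
    rw [← h4]
    refine h1.congr_of_eventuallyEq ?_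
    have : Tendsto (fun t => (t, q.2)) (𝓝 q.1) (𝓝 q) := by
      have : ContinuousAt (fun t => (t, q.2)) q.1 := by fun_prop
      simpa [ContinuousAt] using this
    exact this.eventually hk
  · intro n
    have : Tendsto (fun x => (q.1, x)) (𝓝 q.2) (𝓝 q) := by
      have : ContinuousAt (fun x => (q.1, x)) q.2 := by fun_prop
      simpa [ContinuousAt] using this
    have he : (fun x => k (q.1, x)) =ᶠ[𝓝 q.2] fun x => w (T q.1, X q.1 * x + Y q.1) :=
      this.eventually hk
    rw [he.iteratedDeriv_eq]
    exact iteratedDeriv_comp_affine (fun x => w (T q.1, x)) _ _ _ _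

/-- The equation for `w` in terms of its composition `k` with `(t, x) ↦ (T(t), X(t) x + Y(t))`. -/
theorem equation_comp_affine_base {T X Y : ℝ → ℝ} {T' X' Y' : ℝ} {q : ℝ × ℝ} {w k : ℝ × ℝ → ℝ}
    (hT : HasDerivAt T T' q.1) (hX : HasDerivAt X X' q.1) (hY : HasDerivAt Y Y' q.1)
    (hT0 : T' ≠ 0) (hX0 : X q.1 ≠ 0)
    (hw : ContDiffAt ℝ ∞ w (T q.1, X q.1 * q.2 + Y q.1))
    (hk : ∀ᶠ r in 𝓝 q, k r = w (T r.1, X r.1 * r.2 + Y r.1)) (a b s : ℝ) :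
    deriv (fun t => w (t, X q.1 * q.2 + Y q.1)) (T q.1)
      + a * deriv (fun x => w (T q.1, x)) (X q.1 * q.2 + Y q.1)
      + b * iteratedDeriv 3 (fun x => w (T q.1, x)) (X q.1 * q.2 + Y q.1)
      + s * iteratedDeriv 5 (fun x => w (T q.1, x)) (X q.1 * q.2 + Y q.1) = 0 ↔
    X q.1 ^ 5 * deriv (fun t => k (t, q.2)) q.1
      + X q.1 ^ 4 * (T' * a - (X' * q.2 + Y')) * deriv (fun x => k (q.1, x)) q.2
      + X q.1 ^ 2 * T' * b * iteratedDeriv 3 (fun x => k (q.1, x)) q.2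
      + T' * s * iteratedDeriv 5 (fun x => k (q.1, x)) q.2 = 0 := by
  obtain ⟨h1, h2⟩ := derivs_comp_affine_base hT hX hY hw hk
  have h3 := h2 1
  rw [iteratedDeriv_one, iteratedDeriv_one] at h3
  rw [h1.deriv, h3, h2 3, h2 5]
  rw [← mul_right_inj' (mul_ne_zero hT0 (pow_ne_zero 5 hX0)), mul_zero]
  constructor <;> intro h <;> linear_combination h

/-- Expansion of the change of `V` along a curve under a change of order four of the curve. -/
theorem isLittleO_quartic_perturbation {V Vu : ℝ × ℝ → ℝ} {x₀ u₀ b : ℝ} {D : ℝ × ℝ →L[ℝ] ℝ}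
    (hV : ∀ᶠ y in 𝓝 (x₀, u₀), HasDerivAt (fun u => V (y.1, u)) (Vu y) y.2)
    (hD : HasFDerivAt Vu D (x₀, u₀)) :
    (fun x => V (x, u₀ + b * (x - x₀) + (x - x₀) ^ 4) - V (x, u₀ + b * (x - x₀))
      - (Vu (x₀, u₀) * (x - x₀) ^ 4 + D (1, b) * (x - x₀) ^ 5)) =o[𝓝 x₀]
      fun x => (x - x₀) ^ 5 := by
  rw [isLittleO_iff]
  intro ε hε
  -- `C |z|` bounds the displacement `(z, b z + κ)` for `0 ≤ κ ≤ z^4` and `|z| < 1`.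
  set C : ℝ := 2 + |b| with hC
  have hC0 : 0 < C := by positivity
  have hev := hV.and (hD.isLittleO.def (show 0 < ε / 2 / C by positivity))
  obtain ⟨ρ, hρ, hball⟩ := Metric.eventually_nhds_iff_ball.1 hev
  set E : ℝ := |D (0, 1)| + 1 with hE
  have hE0 : 0 < E := by positivity
  have hsmall : ∀ᶠ x in 𝓝 x₀, |x - x₀| < min 1 (min (ρ / C) (ε / 2 / E)) := by
    have : Tendsto (fun x => |x - x₀|) (𝓝 x₀) (𝓝 0) := by
      have : ContinuousAt (fun x => |x - x₀|) x₀ := by fun_prop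
      simpa [ContinuousAt] using this
    exact this.eventually (gt_mem_nhds (by positivity))
  filter_upwards [hsmall] with x hx
  obtain ⟨hx1, hx2, hx3⟩ : |x - x₀| < 1 ∧ |x - x₀| < ρ / C ∧ |x - x₀| < ε / 2 / E := by
    simpa [lt_min_iff] using hx
  set z := x - x₀ with hz
  have hz0 := abs_nonneg z
  have hz4 : z ^ 4 = |z| ^ 4 := by rw [← abs_pow]; exact (abs_of_nonneg (by positivity)).symm
  have hz2 : |z| ^ 4 ≤ |z| ^ 2 := pow_le_pow_of_le_one hz0 hx1.le (by norm_num)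
  have hz1 : |z| ^ 2 ≤ |z| := by nlinarith
  -- The expansion follows from the mean value inequality in the vertical direction. The segment has
  -- length `z^4` and the derivative differs from its linear approximation by at most `ε |z|`, so
  -- the error is at most `ε |z|^5`.
  have hderiv : ∀ κ ∈ Set.Icc 0 (z ^ 4), HasDerivWithinAt
      (fun κ => V (x, u₀ + b * z + κ) - (Vu (x₀, u₀) + D (1, b) * z) * κ)
      (Vu (x, u₀ + b * z + κ) - (Vu (x₀, u₀) + D (1, b) * z)) (Set.Icc 0 (z ^ 4)) κ ∧
      ‖Vu (x, u₀ + b * z + κ) - (Vu (x₀, u₀) + D (1, b) * z)‖ ≤ ε * |z| := by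
    intro κ hκ
    have hκ4 : κ ≤ |z| ^ 4 := by rw [← hz4]; exact hκ.2
    have hdiff : ((x, u₀ + b * z + κ) - (x₀, u₀) : ℝ × ℝ) = (z, b * z + κ) := by
      ext
      · simp [hz]
      · simp; ring
    have hnorm : ‖((z, b * z + κ) : ℝ × ℝ)‖ ≤ C * |z| := by
      rw [Prod.norm_def, max_le_iff, Real.norm_eq_abs, Real.norm_eq_abs]
      constructor
      · nlinarith [abs_nonneg b]
      · calc |b * z + κ| ≤ |b * z| + |κ| := abs_add_le _ _
          _ ≤ |b| * |z| + |z| := by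
            rw [abs_mul, abs_of_nonneg hκ.1]; linarith
          _ ≤ C * |z| := by nlinarith
    have hmem : (x, u₀ + b * z + κ) ∈ Metric.ball (x₀, u₀) ρ := by
      rw [mem_ball_iff_norm, hdiff]
      refine hnorm.trans_lt ?_
      rwa [lt_div_iff₀' hC0] at hx2
    obtain ⟨h1, h2⟩ := hball _ hmem
    constructor
    · refine HasDerivAt.hasDerivWithinAt ?_
      have h3 : HasDerivAt (fun κ => V (x, u₀ + b * z + κ)) (Vu (x, u₀ + b * z + κ)) κ :=
        HasDerivAt.comp_const_add (f := fun u => V (x, u)) (u₀ + b * z) κ h1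
      have h4 := hasDerivAt_const_mul (x := κ) (Vu (x₀, u₀) + D (1, b) * z)
      exact h3.sub h4
    · rw [hdiff] at h2
      have hDz : D (z, b * z + κ) = D (1, b) * z + κ * D (0, 1) := by
        have : ((z, b * z + κ) : ℝ × ℝ) = z • ((1, b) : ℝ × ℝ) + κ • ((0, 1) : ℝ × ℝ) := by
          ext <;> simp; ring
        rw [this, map_add, map_smul, map_smul, smul_eq_mul, smul_eq_mul, mul_comm z]
      have e : Vu (x, u₀ + b * z + κ) - (Vu (x₀, u₀) + D (1, b) * z) =
        (Vu (x, u₀ + b * z + κ) - Vu (x₀, u₀) - D (z, b * z + κ)) + κ * D (0, 1) := by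
        rw [hDz]; ring
      rw [e]
      refine (norm_add_le _ _).trans ?_
      have h5 : ‖κ * D (0, 1)‖ ≤ ε / 2 * |z| := by
        rw [Real.norm_eq_abs, abs_mul, abs_of_nonneg hκ.1]
        rw [lt_div_iff₀ hE0] at hx3
        have := abs_nonneg (D (0, 1))
        calc κ * |D (0, 1)| ≤ (|z| * |z|) * |D (0, 1)| := by gcongr; nlinarith
          _ ≤ (|z| * E) * |z| := by nlinarith
          _ ≤ ε / 2 * |z| := by gcongr
      have h6 : ε / 2 / C * ‖((z, b * z + κ) : ℝ × ℝ)‖ ≤ ε / 2 * |z| := by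
        calc ε / 2 / C * ‖((z, b * z + κ) : ℝ × ℝ)‖ ≤ ε / 2 / C * (C * |z|) := by gcongr
          _ = ε / 2 * |z| := by field_simp
      linarith
  have hmv := (convex_Icc (0 : ℝ) (z ^ 4)).norm_image_sub_le_of_norm_hasDerivWithin_le
    (fun κ hκ => (hderiv κ hκ).1) (fun κ hκ => (hderiv κ hκ).2)
    (Set.left_mem_Icc.2 (by positivity)) (Set.right_mem_Icc.2 (by positivity))
  have e1 : V (x, u₀ + b * z + z ^ 4) - V (x, u₀ + b * z)
      - (Vu (x₀, u₀) * z ^ 4 + D (1, b) * z ^ 5) =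
      V (x, u₀ + b * z + z ^ 4) - (Vu (x₀, u₀) + D (1, b) * z) * z ^ 4 -
      (V (x, u₀ + b * z + 0) - (Vu (x₀, u₀) + D (1, b) * z) * 0) := by ring_nf
  rw [e1]
  refine hmv.trans (le_of_eq ?_)
  rw [sub_zero, Real.norm_eq_abs, Real.norm_eq_abs, abs_pow, abs_pow]
  ring

/-- The new independent variables are `T(t)` and `X(t) x + Y(t)`. -/
structure LocalMap.HasAffineBase (Φ : LocalMap) (T X Y : ℝ → ℝ) : Prop where
  smooth_T : ContDiffOn ℝ ∞ T Φ.times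
  smooth_X : ContDiffOn ℝ ∞ X Φ.times
  smooth_Y : ContDiffOn ℝ ∞ Y Φ.times
  deriv_ne : ∀ t ∈ Φ.times, deriv T t ≠ 0
  X_ne : ∀ t ∈ Φ.times, X t ≠ 0
  eq : ∀ t x u, (t, x, u) ∈ Φ.dom →
    (Φ.toFun (t, x, u)).1 = T t ∧ (Φ.toFun (t, x, u)).2.1 = X t * x + Y t

theorem LocalMap.differentiableAt_of_times {Φ : LocalMap} {k : ℝ → ℝ}
    (hk : ContDiffOn ℝ ∞ k Φ.times) {t : ℝ} (ht : t ∈ Φ.times) : DifferentiableAt ℝ k t :=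
  (hk.contDiffAt (Φ.isOpen_times.mem_nhds ht)).differentiableAt (by simp)

theorem LocalMap.eventually_graph_mem {Φ : LocalMap} {f : ℝ × ℝ → ℝ} {q : ℝ × ℝ}
    (hf : ContinuousAt f q) (hq : (q.1, q.2, f q) ∈ Φ.dom) :
    ∀ᶠ r in 𝓝 q, (r.1, r.2, f r) ∈ Φ.dom := by
  have hc : ContinuousAt (fun r : ℝ × ℝ => (r.1, r.2, f r)) q := by fun_prop
  exact hc.eventually_mem (Φ.isOpen_dom.mem_nhds hq)

namespace LocalMap.HasAffineBase

variable {Φ : LocalMap} {T X Y : ℝ → ℝ} {f : ℝ × ℝ → ℝ} {q : ℝ × ℝ}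

theorem hasDerivAt (H : Φ.HasAffineBase T X Y) {t : ℝ} (ht : t ∈ Φ.times) :
    HasDerivAt T (deriv T t) t ∧ HasDerivAt X (deriv X t) t ∧ HasDerivAt Y (deriv Y t) t :=
  ⟨(differentiableAt_of_times H.smooth_T ht).hasDerivAt,
    (differentiableAt_of_times H.smooth_X ht).hasDerivAt,
    (differentiableAt_of_times H.smooth_Y ht).hasDerivAt⟩

theorem base_eq (H : Φ.HasAffineBase T X Y) {r : ℝ × ℝ} (hr : (r.1, r.2, f r) ∈ Φ.dom) :
    Φ.base f r = (T r.1, X r.1 * r.2 + Y r.1) :=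
  Prod.ext (H.eq _ _ _ hr).1 (H.eq _ _ _ hr).2

theorem eventually_base_eq (H : Φ.HasAffineBase T X Y)
    (hf : ContinuousAt f q) (hq : (q.1, q.2, f q) ∈ Φ.dom) :
    Φ.base f =ᶠ[𝓝 q] fun r => (T r.1, X r.1 * r.2 + Y r.1) :=
  (eventually_graph_mem hf hq).mono fun _ hr => H.base_eq hr

theorem fderiv_base_injective (H : Φ.HasAffineBase T X Y)
    (hf : ContinuousAt f q) (hq : (q.1, q.2, f q) ∈ Φ.dom) (v : ℝ × ℝ)
    (hv : fderiv ℝ (Φ.base f) q v = 0) : v = 0 := by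
  have ht : q.1 ∈ Φ.times := ⟨_, hq, rfl⟩
  obtain ⟨hT, hX, hY⟩ := H.hasDerivAt ht
  have h1 : HasFDerivAt (fun r : ℝ × ℝ => T r.1) (deriv T q.1 • ContinuousLinearMap.fst ℝ ℝ ℝ) q :=
    hT.comp_hasFDerivAt q hasFDerivAt_fst
  have h2 : HasFDerivAt (fun r : ℝ × ℝ => X r.1) (deriv X q.1 • ContinuousLinearMap.fst ℝ ℝ ℝ) q :=
    hX.comp_hasFDerivAt q hasFDerivAt_fst
  have h3 : HasFDerivAt (fun r : ℝ × ℝ => Y r.1) (deriv Y q.1 • ContinuousLinearMap.fst ℝ ℝ ℝ) q :=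
    hY.comp_hasFDerivAt q hasFDerivAt_fst
  have h4 : HasFDerivAt (fun r : ℝ × ℝ => (T r.1, X r.1 * r.2 + Y r.1)) _ q :=
    h1.prodMk ((h2.mul hasFDerivAt_snd).add h3)
  rw [(H.eventually_base_eq hf hq).fderiv_eq, h4.fderiv] at hv
  have e1 := congrArg Prod.fst hv
  have e2 := congrArg Prod.snd hv
  simp [H.deriv_ne _ ht] at e1
  simp [e1, H.X_ne _ ht] at e2
  exact Prod.ext e1 e2

end LocalMap.HasAffineBase

/-! ### The new dependent variable is affine in `u` -/

section AffineBase

variable {I : Set ℝ} {θ θ' : Coeffs} {Φ : LocalMap} {T X Y : ℝ → ℝ} {f f₂ k : ℝ × ℝ → ℝ}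
  {q : ℝ × ℝ}

/-- The linear equation for the change of the new dependent variable. -/
theorem Admissible.perturbation_equation (h : Admissible I θ Φ θ') (H : Φ.HasAffineBase T X Y)
    (hq : (q.1, q.2, f q) ∈ Φ.dom) (hval : f₂ q = f q)
    (hf : ContDiffAt ℝ ∞ f q) (hf₂ : ContDiffAt ℝ ∞ f₂ q)
    (hs : θ.HoldsAt f q) (hs₂ : θ.HoldsAt f₂ q)
    (hk : ∀ᶠ r in 𝓝 q, k r = (Φ.toFun (r.1, r.2, f₂ r)).2.2 - (Φ.toFun (r.1, r.2, f r)).2.2) :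
    X q.1 ^ 5 * deriv (fun t => k (t, q.2)) q.1
      + X q.1 ^ 4 * (deriv T q.1 * (θ'.α (T q.1) * (Φ.toFun (q.1, q.2, f q)).2.2)
        - (deriv X q.1 * q.2 + deriv Y q.1)) * deriv (fun x => k (q.1, x)) q.2
      + X q.1 ^ 2 * deriv T q.1 * θ'.β (T q.1) * iteratedDeriv 3 (fun x => k (q.1, x)) q.2
      + deriv T q.1 * θ'.σ (T q.1) * iteratedDeriv 5 (fun x => k (q.1, x)) q.2 = 0 := by
  have hq₂ : (q.1, q.2, f₂ q) ∈ Φ.dom := by rwa [hval]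
  have ht : q.1 ∈ Φ.times := ⟨_, hq, rfl⟩
  obtain ⟨q', w, R, c, hq', hw, -, -, -, -, -, hwk, heq⟩ := h.exists_perturbation hq hval hf hf₂ hs hs₂
    (H.fderiv_base_injective hf.continuousAt hq) (H.fderiv_base_injective hf₂.continuousAt hq₂)
  have hb := H.eventually_base_eq hf.continuousAt hq
  have hk' := hwk (hb.trans (H.eventually_base_eq hf₂.continuousAt hq₂).symm)
  rw [H.base_eq hq] at hq'
  subst hq'
  obtain ⟨hT, hX, hY⟩ := H.hasDerivAt ht
  refine (equation_comp_affine_base hT hX hY (H.deriv_ne _ ht) (H.X_ne _ ht) hw ?_ _ _ _).1 heq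
  filter_upwards [hk, hk', hb] with r h1 h2 h3
  rw [h1, ← h2, h3]

/-- The equation for the new dependent variable in the old independent variables. -/
theorem Admissible.solution_equation (h : Admissible I θ Φ θ') (H : Φ.HasAffineBase T X Y)
    (hq : (q.1, q.2, f q) ∈ Φ.dom) (hf : ContDiffAt ℝ ∞ f q) (hs : θ.HoldsAt f q)
    (hk : ∀ᶠ r in 𝓝 q, k r = (Φ.toFun (r.1, r.2, f r)).2.2) :
    X q.1 ^ 5 * deriv (fun t => k (t, q.2)) q.1
      + X q.1 ^ 4 * (deriv T q.1 * (θ'.α (T q.1) * (Φ.toFun (q.1, q.2, f q)).2.2)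
        - (deriv X q.1 * q.2 + deriv Y q.1)) * deriv (fun x => k (q.1, x)) q.2
      + X q.1 ^ 2 * deriv T q.1 * θ'.β (T q.1) * iteratedDeriv 3 (fun x => k (q.1, x)) q.2
      + deriv T q.1 * θ'.σ (T q.1) * iteratedDeriv 5 (fun x => k (q.1, x)) q.2 = 0 := by
  have ht : q.1 ∈ Φ.times := ⟨_, hq, rfl⟩
  obtain ⟨g, -, hg, -⟩ := h.1.exists_carriesGraph hf hq (H.fderiv_base_injective hf.continuousAt hq)
  have heq := (h.2.2.2 _ _ _ _ hg).1 hs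
  have hgq : g (Φ.base f q) = (Φ.toFun (q.1, q.2, f q)).2.2 := hg.eventually_eq.self_of_nhds
  have hw := hg.2.2.1
  unfold Coeffs.HoldsAt at heq
  rw [hgq] at heq
  rw [H.base_eq hq] at heq hw
  obtain ⟨hT, hX, hY⟩ := H.hasDerivAt ht
  refine (equation_comp_affine_base hT hX hY (H.deriv_ne _ ht) (H.X_ne _ ht) hw ?_ _ _ _).1 heq
  filter_upwards [hk, hg.eventually_eq, H.eventually_base_eq hf.continuousAt hq] with r h1 h2 h3
  rw [h1, ← h2, h3]

/-- The new dependent variable is affine in `u`. -/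
theorem Admissible.exists_fderiv_u (h : Admissible I θ Φ θ') (hθ : θ.InClass I)
    (H : Φ.HasAffineBase T X Y) : ∃ k : ℝ → ℝ, ContDiffOn ℝ ∞ k Φ.times ∧ (∀ t ∈ Φ.times, k t ≠ 0) ∧
      ∀ p ∈ Φ.dom, (fderiv ℝ Φ.toFun p (0, 0, 1)).2.2 = k p.1 := by
  have hΦ := h.1
  have hD : ContDiffOn ℝ ∞ (fderiv ℝ Φ.toFun) Φ.dom := hΦ.1.fderiv_of_isOpen Φ.isOpen_dom (by simp)
  set K : ℝ × ℝ × ℝ → ℝ := fun p => (fderiv ℝ Φ.toFun p (0, 0, 1)).2.2 with hKdef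
  have hK : ContDiffOn ℝ ∞ K Φ.dom := by
    have := hD.clm_apply (contDiffOn_const (c := ((0, 0, 1) : ℝ × ℝ × ℝ)))
    fun_prop
  have hKd : ∀ p ∈ Φ.dom, HasFDerivAt K (fderiv ℝ K p) p := fun p hp =>
    ((hK.contDiffAt (Φ.isOpen_dom.mem_nhds hp)).differentiableAt (by simp)).hasFDerivAt
  -- This is `D_x ũ_u = 0` for every slope `b`, so both the `x`- and the `u`-derivative of `ũ_u`
  -- vanish.
  have hzero : ∀ p ∈ Φ.dom, ∀ b : ℝ, fderiv ℝ K p (0, 1, b) = 0 := by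
    rintro ⟨t, x, u⟩ hp b
    have ht : t ∈ Φ.times := ⟨_, hp, rfl⟩
    have hσ' : θ'.σ (T t) ≠ 0 := by
      rw [← (H.eq _ _ _ hp).1]
      exact (h.2.2.1.2 _ ⟨_, ⟨_, hp, rfl⟩, rfl⟩).2.2
    let q : ℝ × ℝ := (t, x)
    -- The perturbation `(x - x₀)^4` changes no derivative in the equation. Its image starts with
    -- `ũ_u (x - x₀)^4 + (D_x ũ_u) (x - x₀)^5`, of which only the last term is seen by the new
    -- equation.
    have heq := h.perturbation_equation H (f := jetPoly q u (-(θ.α q.1 * u * b)) b 0 0 0 0)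
      (f₂ := jetPoly q u (-(θ.α q.1 * u * b)) b 0 1 0 0) (q := q) (by simpa using hp) (by simp)
      (contDiff_jetPoly _ _ _ _ _ _ _ _).contDiffAt (contDiff_jetPoly _ _ _ _ _ _ _ _).contDiffAt
      ((θ.holdsAt_jetPoly _ _ _ _ _ _ _ _).2 (by ring)) ((θ.holdsAt_jetPoly _ _ _ _ _ _ _ _).2 (by ring))
      (Eventually.of_forall fun r => rfl)
    have hincl : HasFDerivAt (fun y : ℝ × ℝ => (t, y))
        ((0 : ℝ × ℝ →L[ℝ] ℝ).prod (ContinuousLinearMap.id ℝ _)) (x, u) :=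
      (hasFDerivAt_const t _).prodMk (hasFDerivAt_id _)
    have hV : ∀ᶠ y : ℝ × ℝ in 𝓝 (x, u), HasDerivAt (fun v => (Φ.toFun (t, y.1, v)).2.2) (K (t, y)) y.2 := by
      have : ∀ᶠ y : ℝ × ℝ in 𝓝 (x, u), (t, y) ∈ Φ.dom :=
        hincl.continuousAt.eventually_mem (Φ.isOpen_dom.mem_nhds hp)
      filter_upwards [this] with y hy
      have h1 : HasDerivAt (fun v => Φ.toFun (t, y.1, v)) (fderiv ℝ Φ.toFun (t, y) (0, 0, 1)) y.2 :=
        HasFDerivAt.comp_hasDerivAt (l := Φ.toFun) y.2 (hΦ.hasFDerivAt hy)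
          ((hasDerivAt_const _ _).prodMk ((hasDerivAt_const _ _).prodMk (hasDerivAt_id _)))
      exact h1.snd.snd
    have hexp := isLittleO_quartic_perturbation (V := fun y => (Φ.toFun (t, y)).2.2)
      (Vu := fun y => K (t, y)) (b := b) hV ((hKd _ hp).comp (x, u) hincl)
    have hφ : ContDiffAt ℝ ∞ (fun y => (Φ.toFun (t, y, u + b * (y - x) + (y - x) ^ 4)).2.2
        - (Φ.toFun (t, y, u + b * (y - x))).2.2) x := by
      have hU : ContDiffAt ℝ ∞ (fun p => (Φ.toFun p).2.2) (t, x, u) := by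
        have := hΦ.contDiffAt hp
        fun_prop
      have a1 : ContDiffAt ℝ ∞ (fun y => (Φ.toFun (t, y, u + b * (y - x) + (y - x) ^ 4)).2.2) x :=
        ContDiffAt.comp (g := fun p => (Φ.toFun p).2.2) x (by simpa using hU) (by fun_prop)
      have a2 : ContDiffAt ℝ ∞ (fun y => (Φ.toFun (t, y, u + b * (y - x))).2.2) x :=
        ContDiffAt.comp (g := fun p => (Φ.toFun p).2.2) x (by simpa using hU) (by fun_prop)
      exact a1.sub a2
    obtain ⟨d1, d3, d5⟩ := derivs_of_expansion hφ hexp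
    have e0 : (fun s : ℝ => (Φ.toFun (s, x, jetPoly q u (-(θ.α q.1 * u * b)) b 0 1 0 0 (s, x))).2.2
        - (Φ.toFun (s, x, jetPoly q u (-(θ.α q.1 * u * b)) b 0 0 0 0 (s, x))).2.2) = fun _ => 0 := by
      funext s; simp [jetPoly, q]
    have e1 : (fun y : ℝ => (Φ.toFun (t, y, jetPoly q u (-(θ.α q.1 * u * b)) b 0 1 0 0 (t, y))).2.2
        - (Φ.toFun (t, y, jetPoly q u (-(θ.α q.1 * u * b)) b 0 0 0 0 (t, y))).2.2) =
        fun y => (Φ.toFun (t, y, u + b * (y - x) + (y - x) ^ 4)).2.2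
          - (Φ.toFun (t, y, u + b * (y - x))).2.2 := by
      funext s; simp [jetPoly, q]
    simp only [q] at heq e0 e1
    rw [e0, e1, d1, d3, d5] at heq
    simpa [H.deriv_ne _ ht, hσ'] using heq
  have hx : ∀ p ∈ Φ.dom, fderiv ℝ K p (0, 1, 0) = 0 := fun p hp => hzero p hp 0
  have hu : ∀ p ∈ Φ.dom, fderiv ℝ K p (0, 0, 1) = 0 := fun p hp => by
    have : ((0, 0, 1) : ℝ × ℝ × ℝ) = (0, 1, 1) - (0, 1, 0) := by ext <;> simp
    rw [this, map_sub, hzero p hp, hx p hp, sub_zero]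
  obtain ⟨k, hk, hke⟩ := LocalMap.exists_eq_comp_fst hK fun t y z hy hz =>
    LocalMap.eq_of_fderiv_eq_zero (fun p hp => (hKd p hp).differentiableAt) hx hu hy hz
  refine ⟨k, hk, ?_, fun p hp => hke p.1 p.2 hp⟩
  rintro _ ⟨p, hp, rfl⟩ h0
  have h1 : K p = 0 := (hke p.1 p.2 hp).trans h0
  have h2 : fderiv ℝ Φ.toFun p (0, 0, 1) = 0 :=
    Prod.ext (h.fderiv_time_eq_zero hθ hp).2 (Prod.ext (h.fderiv_space hθ hp).1 h1)
  have := (hΦ.2.2 p hp).1 (h2.trans (map_zero _).symm)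
  simp at this

end AffineBase

/-! ### The determining equations -/

section

variable {I : Set ℝ} {θ θ' : Coeffs} {Φ : LocalMap} {T X Y k : ℝ → ℝ}

/-- The function `ũ - k(t) u` has zero `u`-derivative. The argument is confined to a ball because a
vertical line may meet the domain in several pieces. -/
theorem LocalMap.IsPointTransformation.eventually_sub_eq (hΦ : Φ.IsPointTransformation)
    (hk : ∀ p ∈ Φ.dom, (fderiv ℝ Φ.toFun p (0, 0, 1)).2.2 = k p.1)
    {f f₂ : ℝ × ℝ → ℝ} {q : ℝ × ℝ} (hq : (q.1, q.2, f q) ∈ Φ.dom) (hval : f₂ q = f q)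
    (hf : ContinuousAt f q) (hf₂ : ContinuousAt f₂ q) :
    ∀ᶠ r in 𝓝 q, (Φ.toFun (r.1, r.2, f₂ r)).2.2 - (Φ.toFun (r.1, r.2, f r)).2.2 =
      k r.1 * (f₂ r - f r) := by
  obtain ⟨ε, hε, hball⟩ := Metric.mem_nhds_iff.1 (Φ.isOpen_dom.mem_nhds hq)
  have hc : ContinuousAt (fun r : ℝ × ℝ => (r.1, r.2, f r)) q := by fun_prop
  have hc₂ : ContinuousAt (fun r : ℝ × ℝ => (r.1, r.2, f₂ r)) q := by fun_prop
  filter_upwards [hc.eventually_mem (Metric.ball_mem_nhds _ hε),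
    hc₂.eventually_mem (by simpa [hval] using Metric.ball_mem_nhds _ hε)] with r h1 h2
  have hconv : Convex ℝ {v : ℝ | (r.1, r.2, v) ∈ Metric.ball (q.1, q.2, f q) ε} := by
    intro v hv v' hv' a b ha hb hab
    have := convex_ball (q.1, q.2, f q) ε hv hv' ha hb hab
    have e : a • (r.1, r.2, v) + b • (r.1, r.2, v') = (r.1, r.2, a • v + b • v') := by
      ext <;> simp [← add_mul, hab]
    rwa [e] at this
  have hd : ∀ v ∈ {v : ℝ | (r.1, r.2, v) ∈ Metric.ball (q.1, q.2, f q) ε},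
      HasDerivWithinAt (fun v => (Φ.toFun (r.1, r.2, v)).2.2 - k r.1 * v) 0
        {v : ℝ | (r.1, r.2, v) ∈ Metric.ball (q.1, q.2, f q) ε} v := by
    intro v hv
    have h3 : HasDerivAt (fun v => Φ.toFun (r.1, r.2, v)) (fderiv ℝ Φ.toFun (r.1, r.2, v) (0, 0, 1)) v :=
      HasFDerivAt.comp_hasDerivAt (l := Φ.toFun) v (hΦ.hasFDerivAt (hball hv))
        ((hasDerivAt_const _ _).prodMk ((hasDerivAt_const _ _).prodMk (hasDerivAt_id _)))
    have h3' : HasDerivAt (fun v => (Φ.toFun (r.1, r.2, v)).2.2) _ v := h3.snd.snd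
    have h4 : HasDerivAt (fun v => (Φ.toFun (r.1, r.2, v)).2.2 - k r.1 * v) _ v :=
      h3'.sub (hasDerivAt_const_mul (k r.1))
    have h5 : (fderiv ℝ Φ.toFun (r.1, r.2, v) (0, 0, 1)).2.2 = k r.1 := hk _ (hball hv)
    refine h4.hasDerivWithinAt.congr_deriv ?_
    rw [← h5]
    simp
  have := hconv.norm_image_sub_le_of_norm_hasDerivWithin_le (C := 0) hd (by simp) h1 h2
  rw [zero_mul, norm_le_zero_iff] at this
  linear_combination this

/-- The change of the image is exactly `k(t)` times the perturbation `a (t - t₀) + b (x - x₀) + c (x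
- x₀)^3`. The latter vanishes at the point, so `k'` does not appear and `k` cancels. -/
theorem Admissible.jet_equation (h : Admissible I θ Φ θ') (H : Φ.HasAffineBase T X Y)
    (hks : ContDiffOn ℝ ∞ k Φ.times) (hk0 : ∀ t ∈ Φ.times, k t ≠ 0)
    (hk : ∀ p ∈ Φ.dom, (fderiv ℝ Φ.toFun p (0, 0, 1)).2.2 = k p.1) {t x u : ℝ}
    (hp : (t, x, u) ∈ Φ.dom) {a b c : ℝ} (habc : a + θ.α t * u * b + θ.β t * (6 * c) = 0) :
    X t ^ 5 * a + X t ^ 4 * (deriv T t * (θ'.α (T t) * (Φ.toFun (t, x, u)).2.2)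
        - (deriv X t * x + deriv Y t)) * b + X t ^ 2 * deriv T t * θ'.β (T t) * (6 * c) = 0 := by
  have ht : t ∈ Φ.times := ⟨_, hp, rfl⟩
  let q : ℝ × ℝ := (t, x)
  have heq := h.perturbation_equation H (f := jetPoly q u 0 0 0 0 0 0)
    (f₂ := jetPoly q u a b c 0 0 0) (q := q) (k := fun r => k r.1 * jetPoly q 0 a b c 0 0 0 r)
    (by simpa using hp) (by simp)
    (contDiff_jetPoly _ _ _ _ _ _ _ _).contDiffAt (contDiff_jetPoly _ _ _ _ _ _ _ _).contDiffAt
    ((θ.holdsAt_jetPoly _ _ _ _ _ _ _ _).2 (by ring))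
    ((θ.holdsAt_jetPoly _ _ _ _ _ _ _ _).2 (by linear_combination habc)) (by
      filter_upwards [h.1.eventually_sub_eq hk (f := jetPoly q u 0 0 0 0 0 0)
        (f₂ := jetPoly q u a b c 0 0 0) (q := q) (by simpa using hp) (by simp)
        (contDiff_jetPoly _ _ _ _ _ _ _ _).continuous.continuousAt
        (contDiff_jetPoly _ _ _ _ _ _ _ _).continuous.continuousAt] with r hr
      rw [hr]
      simp only [jetPoly]
      ring)
  obtain ⟨h1, h2, h3, h4⟩ := derivs_jetPoly q 0 a b c 0 0 0
  have hkt : HasDerivAt (fun s => k s * jetPoly q 0 a b c 0 0 0 (s, x)) _ t :=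
    ((LocalMap.differentiableAt_of_times hks ht).hasDerivAt).mul h1
  simp only [q, deriv_const_mul_field, iteratedDeriv_const_mul_field] at heq h2 h3 h4 hkt
  rw [hkt.deriv, h2, h3, h4, jetPoly_self, jetPoly_self] at heq
  refine mul_left_cancel₀ (hk0 t ht) ?_
  linear_combination heq

/-- The laws for `β` and `σ`, and the new dependent variable. -/
theorem Admissible.coefficient_equations (h : Admissible I θ Φ θ') (hθ : θ.InClass I)
    (H : Φ.HasAffineBase T X Y) :
    (∀ t ∈ Φ.times, deriv T t * θ'.β (T t) = X t ^ 3 * θ.β t) ∧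
    ∀ t x u, (t, x, u) ∈ Φ.dom → deriv T t * θ'.α (T t) * (Φ.toFun (t, x, u)).2.2 =
      θ.α t * X t * u + deriv X t * x + deriv Y t := by
  obtain ⟨k, hks, hk0, hk⟩ := h.exists_fderiv_u hθ H
  constructor
  · rintro _ ⟨⟨t, x, u⟩, hp, rfl⟩
    have hX := H.X_ne t ⟨_, hp, rfl⟩
    -- The solutions `(a, b, c)` of the linear constraint are spanned by two vectors: this one
    -- isolates `β`, and the one with `c = 0` below isolates the convective term and hence `ũ`.
    have h1 := h.jet_equation H hks hk0 hk hp (a := -(6 * θ.β t)) (b := 0) (c := 1) (by ring)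
    refine mul_left_cancel₀ (mul_ne_zero (by norm_num : (6 : ℝ) ≠ 0) (pow_ne_zero 2 hX)) ?_
    linear_combination h1
  · intro t x u hp
    have hX := H.X_ne t ⟨_, hp, rfl⟩
    have h1 := h.jet_equation H hks hk0 hk hp (a := -(θ.α t * u)) (b := 1) (c := 0) (by ring)
    refine mul_left_cancel₀ (pow_ne_zero 4 hX) ?_
    linear_combination h1

/-- An affine function that vanishes on an open set of the plane vanishes. -/
theorem coeffs_eq_zero_of_eventually {a b c x u : ℝ}
    (h : ∀ᶠ y : ℝ × ℝ in 𝓝 (x, u), a * y.1 + b * y.2 + c = 0) : a = 0 ∧ b = 0 ∧ c = 0 := by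
  obtain ⟨ε, hε, hball⟩ := Metric.eventually_nhds_iff_ball.1 h
  have h0 := hball (x, u) (Metric.mem_ball_self hε)
  have h1 := hball (x + ε / 2, u) (by
    rw [mem_ball_iff_norm, Prod.norm_def]; simp [abs_of_pos hε, hε])
  have h2 := hball (x, u + ε / 2) (by
    rw [mem_ball_iff_norm, Prod.norm_def]; simp [abs_of_pos hε, hε])
  have ha : a = 0 := (mul_eq_zero.1 (show a * ε = 0 by linear_combination 2 * h1 - 2 * h0)).resolve_right hε.ne'
  have hb : b = 0 := (mul_eq_zero.1 (show b * ε = 0 by linear_combination 2 * h2 - 2 * h0)).resolve_right hε.ne'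
  refine ⟨ha, hb, ?_⟩
  simpa [ha, hb] using h0

theorem LocalMap.eq_const_of_deriv_eq_zero {F : ℝ → ℝ} (hF : DifferentiableOn ℝ F Φ.times)
    (h0 : ∀ t ∈ Φ.times, deriv F t = 0) : ∃ c, ∀ t ∈ Φ.times, F t = c :=
  Φ.isOpen_times.exists_is_const_of_deriv_eq_zero Φ.ordConnected_times.isPreconnected hF h0

/-- The point transformation is affine in `x` and `u`, with coefficients subject to the determining
equations. -/
structure HasAffineForm (I : Set ℝ) (θ : Coeffs) (Φ : LocalMap) (θ' : Coeffs) (δ c₀ c₁ : ℝ)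
    (T X Y : ℝ → ℝ) : Prop where
  base : Φ.HasAffineBase T X Y
  times_subset : Φ.times ⊆ I
  ne : δ ≠ 0
  deriv_X : ∀ t ∈ Φ.times, HasDerivAt X (c₁ * θ.α t * X t ^ 2 / δ) t
  deriv_Y : ∀ t ∈ Φ.times, HasDerivAt Y (c₀ * θ.α t * X t ^ 2 / δ) t
  u_eq : ∀ t x u, (t, x, u) ∈ Φ.dom → (Φ.toFun (t, x, u)).2.2 = δ / X t * u + c₁ * x + c₀
  law : CoefficientLaw Φ.times δ T X θ θ'

/-- Formula `T' α̃ ũ = α X u + X' x + Y'` makes `ũ` affine in `x` and `u` with coefficients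
depending on `t`. Every constant is a solution, and requiring its image to be one gives the
equations for these coefficients. -/
theorem Admissible.exists_hasAffineForm (h : Admissible I θ Φ θ') (hθ : θ.InClass I) :
    ∃ δ c₀ c₁ T X Y, HasAffineForm I θ Φ θ' δ c₀ c₁ T X Y := by
  obtain ⟨T, X, Y, hT, hX, hY, hT0, hX0, he, hσ⟩ := h.exists_affine_base hθ
  have H : Φ.HasAffineBase T X Y := ⟨hT, hX, hY, hT0, hX0, he⟩
  obtain ⟨hβ, hU⟩ := h.coefficient_equations hθ H
  have hα' : ∀ t ∈ Φ.times, θ'.α (T t) ≠ 0 := by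
    rintro _ ⟨⟨t, x, u⟩, hp, rfl⟩
    rw [← (he _ _ _ hp).1]
    exact (h.2.2.1.2 _ ⟨_, ⟨_, hp, rfl⟩, rfl⟩).1
  have hα : ∀ t ∈ Φ.times, θ.α t ≠ 0 := fun t ht => (hθ.2 t (h.2.1 ht)).1
  have hN0 : ∀ t ∈ Φ.times, deriv T t * θ'.α (T t) ≠ 0 := fun t ht =>
    mul_ne_zero (hT0 t ht) (hα' t ht)
  have hN : ContDiffOn ℝ ∞ (fun t => deriv T t * θ'.α (T t)) Φ.times := by
    refine (hT.deriv_of_isOpen Φ.isOpen_times (by simp)).mul (h.2.2.1.1.1.comp hT ?_)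
    rintro _ ⟨⟨t, x, u⟩, hp, rfl⟩
    exact ⟨_, ⟨_, hp, rfl⟩, (he _ _ _ hp).1⟩
  set U : ℝ → ℝ := fun t => θ.α t * X t / (deriv T t * θ'.α (T t)) with hUdef
  set V : ℝ → ℝ := fun t => deriv X t / (deriv T t * θ'.α (T t)) with hVdef
  set W : ℝ → ℝ := fun t => deriv Y t / (deriv T t * θ'.α (T t)) with hWdef
  have hUs : ContDiffOn ℝ ∞ U Φ.times := ((hθ.1.1.mono h.2.1).mul hX).div hN hN0
  have hVs : ContDiffOn ℝ ∞ V Φ.times := (hX.deriv_of_isOpen Φ.isOpen_times (by simp)).div hN hN0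
  have hWs : ContDiffOn ℝ ∞ W Φ.times := (hY.deriv_of_isOpen Φ.isOpen_times (by simp)).div hN hN0
  have hue : ∀ t x u, (t, x, u) ∈ Φ.dom → (Φ.toFun (t, x, u)).2.2 = U t * u + V t * x + W t := by
    intro t x u hp
    have h1 := hU t x u hp
    have h2 := hN0 t ⟨_, hp, rfl⟩
    simp only [hUdef, hVdef, hWdef]
    rw [← mul_right_inj' h2, h1]
    generalize deriv T t * θ'.α (T t) = N at h2
    field_simp
  have hdet : ∀ t x u, (t, x, u) ∈ Φ.dom →
      deriv V t * x + (deriv U t + θ.α t * V t) * u + deriv W t = 0 := by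
    intro t x u hp
    have ht : t ∈ Φ.times := ⟨_, hp, rfl⟩
    let q : ℝ × ℝ := (t, x)
    have heq := h.solution_equation H (f := fun _ => u) (q := q)
      (k := fun r => U r.1 * u + V r.1 * r.2 + W r.1) hp contDiffAt_const
      (by simp [Coeffs.HoldsAt, iteratedDeriv_const]) (by
        filter_upwards [LocalMap.eventually_graph_mem (Φ := Φ) (f := fun _ => u) (q := q)
          continuousAt_const hp] with r hr
        exact (hue _ _ _ hr).symm)
    have dU := (LocalMap.differentiableAt_of_times hUs ht).hasDerivAt
    have dV := (LocalMap.differentiableAt_of_times hVs ht).hasDerivAt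
    have dW := (LocalMap.differentiableAt_of_times hWs ht).hasDerivAt
    have dt : HasDerivAt (fun s => U s * u + V s * x + W s) _ t :=
      ((dU.mul_const u).add (dV.mul_const x)).add dW
    obtain ⟨-, h2, h3, h4⟩ := derivs_jetPoly q (U t * u + V t * x + W t) 0 (V t) 0 0 0 0
    have e : (fun y => jetPoly q (U t * u + V t * x + W t) 0 (V t) 0 0 0 0 (q.1, y)) =
        fun y => U t * u + V t * y + W t := by
      funext y; simp only [jetPoly, q]; ring
    rw [e] at h2 h3 h4
    simp only [q] at heq h2 h3 h4
    rw [dt.deriv, h2, h3, h4] at heq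
    refine mul_left_cancel₀ (pow_ne_zero 5 (hX0 t ht)) ?_
    -- By the formula for `ũ` the transport coefficient `T' α̃ ũ - X' x - Y'` equals `α X u`.
    linear_combination heq - X t ^ 4 * V t * hU t x u hp
  have hcoef : ∀ t ∈ Φ.times, deriv V t = 0 ∧ deriv U t + θ.α t * V t = 0 ∧ deriv W t = 0 := by
    rintro _ ⟨⟨t, x, u⟩, hp, rfl⟩
    refine coeffs_eq_zero_of_eventually (x := x) (u := u) ?_
    have : ∀ᶠ y : ℝ × ℝ in 𝓝 (x, u), (t, y) ∈ Φ.dom :=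
      (by fun_prop : ContinuousAt (fun y : ℝ × ℝ => (t, y)) (x, u)).eventually_mem
        (Φ.isOpen_dom.mem_nhds hp)
    filter_upwards [this] with y hy using hdet t y.1 y.2 hy
  obtain ⟨c₁, hc₁⟩ := LocalMap.eq_const_of_deriv_eq_zero (hVs.differentiableOn (by simp))
    fun t ht => (hcoef t ht).1
  obtain ⟨c₀, hc₀⟩ := LocalMap.eq_const_of_deriv_eq_zero (hWs.differentiableOn (by simp))
    fun t ht => (hcoef t ht).2.2
  have hXd : ∀ t ∈ Φ.times, deriv X t = c₁ * (deriv T t * θ'.α (T t)) := fun t ht => by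
    rw [← hc₁ t ht]; simp only [hVdef]; rw [div_mul_cancel₀ _ (hN0 t ht)]
  have hYd : ∀ t ∈ Φ.times, deriv Y t = c₀ * (deriv T t * θ'.α (T t)) := fun t ht => by
    rw [← hc₀ t ht]; simp only [hWdef]; rw [div_mul_cancel₀ _ (hN0 t ht)]
  have hUN : ∀ t ∈ Φ.times, U t * (deriv T t * θ'.α (T t)) = θ.α t * X t := fun t ht => by
    simp only [hUdef]; rw [div_mul_cancel₀ _ (hN0 t ht)]
  -- Indeed `U' X = -c₁ α X`, while `U X' = c₁ U T' α̃ = c₁ α X`. The constancy of `U X` then yields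
  -- the law for `α`.
  obtain ⟨δ, hδ⟩ := LocalMap.eq_const_of_deriv_eq_zero (F := fun t => U t * X t)
    ((hUs.mul hX).differentiableOn (by simp)) (fun t ht => by
      rw [deriv_fun_mul (LocalMap.differentiableAt_of_times hUs ht)
        (LocalMap.differentiableAt_of_times hX ht), hXd t ht]
      have := (hcoef t ht).2.1
      rw [hc₁ t ht] at this
      linear_combination X t * this + c₁ * hUN t ht)
  have hU0 : ∀ t ∈ Φ.times, U t ≠ 0 := fun t ht =>
    div_ne_zero (mul_ne_zero (hα t ht) (hX0 t ht)) (hN0 t ht)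
  obtain ⟨⟨t₀, y₀⟩, hp₀⟩ := Φ.isConnected_dom.nonempty
  have hδ0 : δ ≠ 0 := by
    rw [← hδ t₀ ⟨_, hp₀, rfl⟩]
    exact mul_ne_zero (hU0 _ ⟨_, hp₀, rfl⟩) (hX0 _ ⟨_, hp₀, rfl⟩)
  have hαlaw : ∀ t ∈ Φ.times, deriv T t * θ'.α (T t) = θ.α t * X t ^ 2 / δ := fun t ht => by
    rw [eq_div_iff hδ0, ← hδ t ht]
    linear_combination X t * hUN t ht
  refine ⟨δ, c₀, c₁, T, X, Y, H, h.2.1, hδ0, fun t ht => ?_, fun t ht => ?_, fun t x u hp => ?_,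
    fun t ht => ⟨?_, ?_, ?_⟩⟩
  · have := (LocalMap.differentiableAt_of_times hX ht).hasDerivAt
    rw [hXd t ht, hαlaw t ht] at this
    exact this.congr_deriv (by ring)
  · have := (LocalMap.differentiableAt_of_times hY ht).hasDerivAt
    rw [hYd t ht, hαlaw t ht] at this
    exact this.congr_deriv (by ring)
  · have ht : t ∈ Φ.times := ⟨_, hp, rfl⟩
    rw [hue t x u hp, ← hδ t ht, hc₁ t ht, hc₀ t ht, mul_div_cancel_right₀ _ (hX0 t ht)]
  · have := hαlaw t ht
    have h0 := hT0 t ht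
    field_simp at this ⊢
    linear_combination this
  · have := hβ t ht
    have h0 := hT0 t ht
    field_simp
    linear_combination this
  · have := hσ t ht
    have h0 := hT0 t ht
    field_simp
    linear_combination -this

end

/-! ### Affine forms are admissible -/

theorem bijective_of_forall_eq_zero {E : Type*} [NormedAddCommGroup E] [NormedSpace ℝ E]
    [FiniteDimensional ℝ E] (L : E →L[ℝ] E) (h : ∀ v, L v = 0 → v = 0) : Function.Bijective L := by
  have hinj : Function.Injective (L : E →ₗ[ℝ] E) := (injective_iff_map_eq_zero _).2 h
  exact ⟨hinj, LinearMap.injective_iff_surjective.1 hinj⟩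

section

variable {I : Set ℝ} {θ θ' : Coeffs} {Φ : LocalMap} {δ c₀ c₁ : ℝ} {T X Y : ℝ → ℝ}

namespace LocalMap

theorem HasAffineBase.newTimes_eq (H : Φ.HasAffineBase T X Y) : Φ.newTimes = T '' Φ.times := by
  ext s
  constructor
  · rintro ⟨_, ⟨⟨t, x, u⟩, hp, rfl⟩, rfl⟩
    exact ⟨t, ⟨_, hp, rfl⟩, (H.eq _ _ _ hp).1.symm⟩
  · rintro ⟨_, ⟨⟨t, x, u⟩, hp, rfl⟩, rfl⟩
    exact ⟨_, ⟨_, hp, rfl⟩, (H.eq _ _ _ hp).1⟩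

/-- Near each new time `φ'` is `φ` composed with a smooth local inverse of `T`. -/
theorem HasAffineBase.contDiffOn_newTimes (H : Φ.HasAffineBase T X Y) {φ φ' : ℝ → ℝ}
    (hφ : ContDiffOn ℝ ∞ φ Φ.times) (h : ∀ t ∈ Φ.times, φ' (T t) = φ t) :
    ContDiffOn ℝ ∞ φ' Φ.newTimes := by
  rw [H.newTimes_eq]
  rintro _ ⟨t, ht, rfl⟩
  refine ContDiffAt.contDiffWithinAt ?_
  have hT : ContDiffAt ℝ ∞ T t := H.smooth_T.contDiffAt (Φ.isOpen_times.mem_nhds ht)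
  obtain ⟨R, hR, hRt, -, hr⟩ := exists_smooth_localInverse hT fun v hv => by
    have : fderiv ℝ T t v = v * deriv T t := by
      rw [← smul_eq_mul, ← fderiv_apply_one_eq_deriv, ← map_smul, smul_eq_mul, mul_one]
    rw [this] at hv
    exact (mul_eq_zero.1 hv).resolve_right (H.deriv_ne t ht)
  have hc : ContDiffAt ℝ ∞ (fun s => φ (R s)) (T t) := by
    refine ContDiffAt.comp (g := φ) _ ?_ hR
    rw [hRt]
    exact hφ.contDiffAt (Φ.isOpen_times.mem_nhds ht)
  refine hc.congr_of_eventuallyEq ?_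
  have hm : ∀ᶠ s in 𝓝 (T t), R s ∈ Φ.times :=
    hR.continuousAt.eventually_mem (by rw [hRt]; exact Φ.isOpen_times.mem_nhds ht)
  filter_upwards [hr, hm] with s h1 h2
  rw [← h _ h2, h1]

end LocalMap

namespace HasAffineForm

theorem toFun_eq (h : HasAffineForm I θ Φ θ' δ c₀ c₁ T X Y) {p : ℝ × ℝ × ℝ} (hp : p ∈ Φ.dom) :
    Φ.toFun p = (T p.1, X p.1 * p.2.1 + Y p.1, δ / X p.1 * p.2.2 + c₁ * p.2.1 + c₀) :=
  Prod.ext (h.base.eq _ _ _ hp).1 (Prod.ext (h.base.eq _ _ _ hp).2 (h.u_eq _ _ _ hp))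

/-- The map is triangular in `t`, `x`, `u` with diagonal entries `T'`, `X`, `δ/X`, none of them
zero; both kinds of injectivity are read off in this order. -/
theorem isPointTransformation (h : HasAffineForm I θ Φ θ' δ c₀ c₁ T X Y) :
    Φ.IsPointTransformation := by
  have hm : Set.MapsTo Prod.fst Φ.dom Φ.times := fun p hp => ⟨p, hp, rfl⟩
  have hX : ContDiffOn ℝ ∞ (fun p : ℝ × ℝ × ℝ => X p.1) Φ.dom :=
    h.base.smooth_X.comp contDiff_fst.contDiffOn hm
  have hU : ContDiffOn ℝ ∞ (fun p : ℝ × ℝ × ℝ => δ / X p.1) Φ.dom :=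
    contDiffOn_const.div hX fun p hp => h.base.X_ne _ (hm hp)
  refine ⟨?_, ?_, ?_⟩
  · refine ContDiffOn.congr ?_ fun p hp => h.toFun_eq hp
    exact (h.base.smooth_T.comp contDiff_fst.contDiffOn hm).prodMk
      (((hX.mul (by fun_prop)).add (h.base.smooth_Y.comp contDiff_fst.contDiffOn hm)).prodMk
        (((hU.mul (by fun_prop)).add (by fun_prop)).add contDiffOn_const))
  · intro p hp p' hp' he
    rw [h.toFun_eq hp, h.toFun_eq hp', Prod.mk.injEq, Prod.mk.injEq] at he
    obtain ⟨e1, e2, e3⟩ := he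
    have ht : p.1 = p'.1 :=
      injOn_of_deriv_ne_zero Φ.ordConnected_times h.base.deriv_ne (hm hp) (hm hp') e1
    rw [ht] at e2 e3
    have hX0 := h.base.X_ne _ (hm hp')
    have hx : p.2.1 = p'.2.1 := mul_left_cancel₀ hX0 (by linear_combination e2)
    rw [hx] at e3
    have hu : p.2.2 = p'.2.2 :=
      mul_left_cancel₀ (div_ne_zero h.ne hX0) (by linear_combination e3)
    exact Prod.ext ht (Prod.ext hx hu)
  · intro p hp
    have ht : p.1 ∈ Φ.times := hm hp
    obtain ⟨dT, dX, dY⟩ := h.base.hasDerivAt ht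
    have hX0 := h.base.X_ne _ ht
    have hcomp : ∀ {F : ℝ → ℝ} {F' : ℝ}, HasDerivAt F F' p.1 →
        HasFDerivAt (fun z : ℝ × ℝ × ℝ => F z.1) (F' • ContinuousLinearMap.fst ℝ ℝ (ℝ × ℝ)) p :=
      fun hF => hF.comp_hasFDerivAt p hasFDerivAt_fst
    have hx : HasFDerivAt (fun z : ℝ × ℝ × ℝ => z.2.1)
        ((ContinuousLinearMap.fst ℝ ℝ ℝ).comp (ContinuousLinearMap.snd ℝ ℝ (ℝ × ℝ))) p :=
      hasFDerivAt_snd.fst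
    have hu : HasFDerivAt (fun z : ℝ × ℝ × ℝ => z.2.2)
        ((ContinuousLinearMap.snd ℝ ℝ ℝ).comp (ContinuousLinearMap.snd ℝ ℝ (ℝ × ℝ))) p :=
      hasFDerivAt_snd.snd
    have dU : HasDerivAt (fun t => δ / X t) _ p.1 := (hasDerivAt_const p.1 δ).div dX hX0
    have hF : HasFDerivAt (fun z : ℝ × ℝ × ℝ =>
        (T z.1, X z.1 * z.2.1 + Y z.1, δ / X z.1 * z.2.2 + c₁ * z.2.1 + c₀)) _ p :=
      (hcomp dT).prodMk ((((hcomp dX).mul hx).add (hcomp dY)).prodMk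
        ((((hcomp dU).mul hu).add (hx.const_mul c₁)).add_const c₀))
    have he : Φ.toFun =ᶠ[𝓝 p] _ :=
      Filter.eventually_of_mem (Φ.isOpen_dom.mem_nhds hp) fun z hz => h.toFun_eq hz
    rw [he.fderiv_eq, hF.fderiv]
    refine bijective_of_forall_eq_zero _ fun v hv => ?_
    have e1 := congrArg Prod.fst hv
    have e2 := congrArg (fun z => z.2.1) hv
    have e3 := congrArg (fun z => z.2.2) hv
    simp [h.base.deriv_ne _ ht] at e1
    simp [e1, hX0] at e2
    simp [e1, e2, hX0, h.ne] at e3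
    exact Prod.ext e1 (Prod.ext e2 e3)

/-- Substitution of `(δ/X) f + c₁ x + c₀` into the new equation: the equations for `X'` and `Y'`
cancel all terms foreign to the old equation. -/
theorem holdsAt_iff (h : HasAffineForm I θ Φ θ' δ c₀ c₁ T X Y) {f g : ℝ × ℝ → ℝ} {q q' : ℝ × ℝ}
    (hc : Φ.CarriesGraph f g q q') : θ.HoldsAt f q ↔ θ'.HoldsAt g q' := by
  have ht : q.1 ∈ Φ.times := ⟨_, hc.1, rfl⟩
  have hf := hc.2.1
  have hX0 := h.base.X_ne _ ht
  have hT0 := h.base.deriv_ne _ ht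
  have hδ := h.ne
  have hb := hc.eq_base
  rw [h.base.base_eq hc.1] at hb
  subst hb
  obtain ⟨dT, -, -⟩ := h.base.hasDerivAt ht
  have dX := h.deriv_X _ ht
  have dY := h.deriv_Y _ ht
  set k : ℝ × ℝ → ℝ := fun r => δ / X r.1 * f r + c₁ * r.2 + c₀ with hkdef
  have hgq : g (T q.1, X q.1 * q.2 + Y q.1) = k q := by
    have := congrArg (fun z => z.2.2) hc.2.2.2.1
    simp only at this
    rw [← this, h.u_eq _ _ _ hc.1]
  have hk : ∀ᶠ r in 𝓝 q, k r = g (T r.1, X r.1 * r.2 + Y r.1) := by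
    filter_upwards [hc.eventually_eq, LocalMap.eventually_graph_mem hf.continuousAt hc.1] with r h1 h2
    rw [h.base.base_eq h2, h.u_eq _ _ _ h2] at h1
    exact h1.symm
  have hiff := equation_comp_affine_base dT dX dY hT0 hX0 hc.2.2.1 hk
    (θ'.α (T q.1) * k q) (θ'.β (T q.1)) (θ'.σ (T q.1))
  have hft : HasDerivAt (fun t => f (t, q.2)) (deriv (fun t => f (t, q.2)) q.1) q.1 :=
    (((ContDiffAt.comp (g := f) q.1 (by simpa using hf) (by fun_prop) :
      ContDiffAt ℝ ∞ (fun t => f (t, q.2)) q.1)).differentiableAt (by simp)).hasDerivAt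
  have hfx : ContDiffAt ℝ ∞ (fun x => f (q.1, x)) q.2 :=
    ContDiffAt.comp (g := f) q.2 (by simpa using hf) (by fun_prop)
  have dkt : HasDerivAt (fun t => k (t, q.2)) _ q.1 :=
    ((((hasDerivAt_const q.1 δ).div dX hX0).mul hft).add_const (c₁ * q.2)).add_const c₀
  obtain ⟨-, j1, j3, j5⟩ := derivs_jetPoly q (c₁ * q.2 + c₀) 0 c₁ 0 0 0 0
  have hkx : (fun x => k (q.1, x)) = fun x => δ / X q.1 * f (q.1, x) +
      jetPoly q (c₁ * q.2 + c₀) 0 c₁ 0 0 0 0 (q.1, x) := by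
    funext x; simp only [hkdef, jetPoly]; ring
  have hj : ContDiffAt ℝ ∞ (fun x => jetPoly q (c₁ * q.2 + c₀) 0 c₁ 0 0 0 0 (q.1, x)) q.2 :=
    (contDiff_jetPoly _ _ _ _ _ _ _ _).contDiffAt.comp q.2 (by fun_prop)
  have dkx : ∀ n : ℕ, iteratedDeriv n (fun x => k (q.1, x)) q.2 =
      δ / X q.1 * iteratedDeriv n (fun x => f (q.1, x)) q.2 +
      iteratedDeriv n (fun x => jetPoly q (c₁ * q.2 + c₀) 0 c₁ 0 0 0 0 (q.1, x)) q.2 := fun n => by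
    rw [hkx, iteratedDeriv_fun_add (contDiffAt_infty.1 (contDiffAt_const.mul hfx) n)
      (contDiffAt_infty.1 hj n), iteratedDeriv_const_mul_field]
  have dk1 := dkx 1
  simp only [iteratedDeriv_one] at dk1
  rw [dkt.deriv, dk1, dkx 3, dkx 5, j1, j3, j5] at hiff
  obtain ⟨l1, l2, l3⟩ := h.law _ ht
  unfold Coeffs.HoldsAt
  rw [hgq]
  refine Iff.trans ?_ hiff.symm
  -- The transformed expression is `δ X^4` times the old one.
  rw [l1, l2, l3, ← mul_right_inj' (mul_ne_zero hδ (pow_ne_zero 4 hX0)), mul_zero]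
  refine Eq.congr_left ?_
  simp only [hkdef, Pi.div_apply]
  field_simp
  ring

theorem admissible (h : HasAffineForm I θ Φ θ' δ c₀ c₁ T X Y) (hθ : θ.InClass I) :
    Admissible I θ Φ θ' := by
  refine ⟨h.isPointTransformation, h.times_subset, ⟨?_, ?_⟩, fun f g q q' hc => h.holdsAt_iff hc⟩
  · have hT' := h.base.smooth_T.deriv_of_isOpen (m := ∞) Φ.isOpen_times (by simp)
    have hX := h.base.smooth_X
    refine ⟨h.base.contDiffOn_newTimes ?_ fun t ht => (h.law t ht).1,
      h.base.contDiffOn_newTimes ?_ fun t ht => (h.law t ht).2.1,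
      h.base.contDiffOn_newTimes ?_ fun t ht => (h.law t ht).2.2⟩
    · exact ((hX.pow 2).div (contDiffOn_const.mul hT')
        fun t ht => mul_ne_zero h.ne (h.base.deriv_ne t ht)).mul (hθ.1.1.mono h.times_subset)
    · exact ((hX.pow 3).div hT' h.base.deriv_ne).mul (hθ.1.2.1.mono h.times_subset)
    · exact ((hX.pow 5).div hT' h.base.deriv_ne).mul (hθ.1.2.2.mono h.times_subset)
  · rw [h.base.newTimes_eq]
    rintro _ ⟨t, ht, rfl⟩
    obtain ⟨l1, l2, l3⟩ := h.law t ht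
    obtain ⟨n1, n2, n3⟩ := hθ.2 t (h.times_subset ht)
    have hX0 := h.base.X_ne t ht
    have hT0 := h.base.deriv_ne t ht
    rw [l1, l2, l3]
    refine ⟨mul_ne_zero (div_ne_zero (pow_ne_zero _ hX0) (mul_ne_zero h.ne hT0)) n1,
      mul_ne_zero (div_ne_zero (pow_ne_zero _ hX0) hT0) n2,
      mul_ne_zero (div_ne_zero (pow_ne_zero _ hX0) hT0) n3⟩

end HasAffineForm

end

/-! ### Existence of the listed transformations and integration of the determining equations -/

section

variable {I : Set ℝ} {θ θ' : Coeffs} {Φ : LocalMap} {A : ℝ → ℝ}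

theorem LocalMap.exists_of_interval {a b : ℝ} (hab : a < b) (F : ℝ × ℝ × ℝ → ℝ × ℝ × ℝ) :
    ∃ Φ : LocalMap, Φ.times = Set.Ioo a b ∧ Φ.toFun = F := by
  refine ⟨⟨Set.Ioo a b ×ˢ Set.univ, F, isOpen_Ioo.prod isOpen_univ,
    (isConnected_Ioo hab).prod isConnected_univ, fun t => ?_⟩, ?_, rfl⟩
  · by_cases ht : t ∈ Set.Ioo a b
    · have : {y : ℝ × ℝ | (t, y) ∈ Set.Ioo a b ×ˢ (Set.univ : Set (ℝ × ℝ))} = Set.univ := by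
        ext y; simpa using ht
      rw [this]; exact isPreconnected_univ
    · have : {y : ℝ × ℝ | (t, y) ∈ Set.Ioo a b ×ˢ (Set.univ : Set (ℝ × ℝ))} = ∅ := by
        ext y
        simp only [Set.mem_ofPred_eq, Set.mem_prod, Set.mem_univ, and_true, Set.mem_empty_iff_false,
          iff_false]
        exact ht
      rw [this]; exact isPreconnected_empty
  · exact Set.fst_image_prod _ Set.univ_nonempty

/-- The coefficients are transported by the inverse of `T` on `J`; their values outside the image of
`J` do not matter. -/
theorem exists_coefficientLaw {J : Set ℝ} {T : ℝ → ℝ} (hT : Set.InjOn T J) (δ : ℝ) (X : ℝ → ℝ)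
    (θ : Coeffs) : ∃ θ', CoefficientLaw J δ T X θ θ' := by
  let R := Function.invFunOn T J
  refine ⟨⟨fun s => X (R s) ^ 2 / (δ * deriv T (R s)) * θ.α (R s),
    fun s => X (R s) ^ 3 / deriv T (R s) * θ.β (R s),
    fun s => X (R s) ^ 5 / deriv T (R s) * θ.σ (R s)⟩, fun t ht => ?_⟩
  have : R (T t) = t := hT.leftInvOn_invFunOn ht
  simp only [this, and_self]

/-- An interval on which `δ₃ A + δ₄` does not vanish. -/
theorem exists_interval_ne_zero (hI : IsOpen I) (hne : I.Nonempty) (hα : ∀ t ∈ I, θ.α t ≠ 0)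
    (hA : ∀ t ∈ I, HasDerivAt A (θ.α t) t) {c d : ℝ} (hcd : c ^ 2 + d ^ 2 ≠ 0) :
    ∃ a b, a < b ∧ Set.Ioo a b ⊆ I ∧ ∀ t ∈ Set.Ioo a b, c * A t + d ≠ 0 := by
  obtain ⟨t₀, ht₀⟩ := hne
  -- The function may vanish at `t₀` itself, but for `c ≠ 0` its derivative `c α` does not, so it
  -- has no zeros just to the right.
  have h1 : ∀ᶠ t in 𝓝[>] t₀, c * A t + d ≠ 0 := by
    by_cases hc : c = 0
    · have : d ≠ 0 := by rintro rfl; simp [hc] at hcd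
      exact Eventually.of_forall fun t => by simpa [hc] using this
    · have h2 : HasDerivAt (fun t => c * A t + d) (c * θ.α t₀) t₀ :=
        ((hA t₀ ht₀).const_mul c).add_const d
      exact (h2.eventually_ne (mul_ne_zero hc (hα t₀ ht₀))).filter_mono
        (nhdsWithin_mono _ fun t ht => ne_of_gt ht)
  have h2 : ∀ᶠ t in 𝓝[>] t₀, t ∈ I := nhdsWithin_le_nhds (hI.mem_nhds ht₀)
  obtain ⟨b, hb, hsub⟩ := mem_nhdsGT_iff_exists_Ioo_subset.1 (h2.and h1)
  exact ⟨t₀, b, hb, fun t ht => (hsub ht).1, fun t ht => (hsub ht).2⟩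

theorem exists_hasForm (hI : IsOpen I) (hne : I.Nonempty) (hθ : θ.InClass I)
    (hA : ∀ t ∈ I, HasDerivAt A (θ.α t) t) (δ : Fin 5 → ℝ) (T : ℝ → ℝ) (hT : ContDiffOn ℝ ∞ T I)
    (hT0 : ∀ t ∈ I, deriv T t ≠ 0) (hδ : δ 2 * (δ 3 ^ 2 + δ 4 ^ 2) ≠ 0) :
    ∃ P : LocalMap × Coeffs, HasForm I θ A δ T P.1 P.2 := by
  obtain ⟨a, b, hab, hsub, h0⟩ := exists_interval_ne_zero hI hne (fun t ht => (hθ.2 t ht).1) hA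
    (right_ne_zero_of_mul hδ)
  obtain ⟨Φ, hΦt, hΦ⟩ := LocalMap.exists_of_interval hab fun p =>
    (T p.1, (p.2.1 + δ 1) * (δ 3 * A p.1 + δ 4)⁻¹ + δ 0,
        δ 2 / (δ 3 * A p.1 + δ 4)⁻¹ * p.2.2 - δ 2 * δ 3 * (p.2.1 + δ 1))
  obtain ⟨θ', hθ'⟩ := exists_coefficientLaw (injOn_of_deriv_ne_zero Set.ordConnected_Ioo
    fun t ht => hT0 t (hsub ht)) (δ 2) (fun t => (δ 3 * A t + δ 4)⁻¹) θ
  rw [← hΦt] at hsub h0 hθ'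
  exact ⟨(Φ, θ'), hsub, hδ, hT.mono hsub, fun t ht => hT0 t (hsub ht), h0,
    fun t x u _ => by rw [hΦ], hθ'⟩

theorem exists_hasGalileanForm (hI : IsOpen I) (hne : I.Nonempty) (hθ : θ.InClass I)
    (hA : ∀ t ∈ I, HasDerivAt A (θ.α t) t) (δ : Fin 5 → ℝ) (T : ℝ → ℝ) (hT : ContDiffOn ℝ ∞ T I)
    (hT0 : ∀ t ∈ I, deriv T t ≠ 0) (h3 : δ 3 = 0) (hδ : δ 2 * δ 4 ≠ 0) :
    ∃ P : LocalMap × Coeffs, HasGalileanForm I θ A δ T P.1 P.2 := by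
  obtain ⟨a, b, hab, hsub, -⟩ := exists_interval_ne_zero hI hne (fun t ht => (hθ.2 t ht).1) hA
    (c := 0) (d := 1) (by norm_num)
  obtain ⟨Φ, hΦt, hΦ⟩ := LocalMap.exists_of_interval hab fun p =>
    (T p.1, (p.2.1 + δ 1 * A p.1) * (δ 4)⁻¹ + δ 0, δ 2 / (δ 4)⁻¹ * (p.2.2 + δ 1))
  obtain ⟨θ', hθ'⟩ := exists_coefficientLaw (injOn_of_deriv_ne_zero Set.ordConnected_Ioo
    fun t ht => hT0 t (hsub ht)) (δ 2) (fun _ => (δ 4)⁻¹) θ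
  rw [← hΦt] at hsub hθ'
  exact ⟨(Φ, θ'), hsub, h3, hδ, hT.mono hsub, fun t ht => hT0 t (hsub ht),
    fun t x u _ => by rw [hΦ], hθ'⟩

theorem contDiffOn_antiderivative (hI : IsOpen I) (hθ : θ.InClass I)
    (hA : ∀ t ∈ I, HasDerivAt A (θ.α t) t) : ContDiffOn ℝ ∞ A I :=
  (contDiffOn_infty_iff_deriv_of_isOpen hI).2
    ⟨fun t ht => (hA t ht).differentiableAt.differentiableWithinAt,
      hθ.1.1.congr fun t ht => (hA t ht).deriv⟩

/-- From `A' = α` one gets `X' = -δ₃ α X²`, which is the required equation with `c₁ = -δ₂ δ₃`; `Y`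
is a multiple of `X` up to a constant. -/
theorem HasForm.hasAffineForm {δ : Fin 5 → ℝ} {T : ℝ → ℝ} (hI : IsOpen I) (hθ : θ.InClass I)
    (hA : ∀ t ∈ I, HasDerivAt A (θ.α t) t) (h : HasForm I θ A δ T Φ θ') :
    HasAffineForm I θ Φ θ' (δ 2) (-(δ 2 * δ 3 * δ 1)) (-(δ 2 * δ 3)) T
      (fun t => (δ 3 * A t + δ 4)⁻¹) (fun t => δ 1 * (δ 3 * A t + δ 4)⁻¹ + δ 0) := by
  obtain ⟨hsub, hδ, hT, hT0, h0, hF, hlaw⟩ := h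
  have hδ2 := left_ne_zero_of_mul hδ
  have hAs : ContDiffOn ℝ ∞ A Φ.times := (contDiffOn_antiderivative hI hθ hA).mono hsub
  have hX : ContDiffOn ℝ ∞ (fun t => (δ 3 * A t + δ 4)⁻¹) Φ.times :=
    ((contDiffOn_const.mul hAs).add contDiffOn_const).inv h0
  have hd : ∀ t ∈ Φ.times, HasDerivAt (fun t => (δ 3 * A t + δ 4)⁻¹)
      (-(δ 3 * θ.α t) / (δ 3 * A t + δ 4) ^ 2) t := fun t ht =>
    (((hA t (hsub ht)).const_mul (δ 3)).add_const (δ 4)).inv (h0 t ht)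
  refine ⟨⟨hT, hX, (contDiffOn_const.mul hX).add contDiffOn_const, hT0,
    fun t ht => inv_ne_zero (h0 t ht), fun t x u hp => ?_⟩, hsub, hδ2, fun t ht => ?_,
    fun t ht => ?_, fun t x u hp => ?_, hlaw⟩
  · rw [hF t x u hp]
    exact ⟨rfl, by ring⟩
  · refine (hd t ht).congr_deriv ?_
    field_simp
  · refine (((hd t ht).const_mul (δ 1)).add_const (δ 0)).congr_deriv ?_
    field_simp
  · rw [hF t x u hp]
    ring

/-- For constant `X` the equation for `X` holds with `c₁ = 0`, and `Y' = δ₁ α X` with `X = δ₄⁻¹`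
fixes `c₀`. -/
theorem HasGalileanForm.hasAffineForm {δ : Fin 5 → ℝ} {T : ℝ → ℝ} (hI : IsOpen I)
    (hθ : θ.InClass I) (hA : ∀ t ∈ I, HasDerivAt A (θ.α t) t)
    (h : HasGalileanForm I θ A δ T Φ θ') :
    HasAffineForm I θ Φ θ' (δ 2) (δ 2 * δ 4 * δ 1) 0 T
      (fun _ => (δ 4)⁻¹) (fun t => δ 1 * A t * (δ 4)⁻¹ + δ 0) := by
  obtain ⟨hsub, -, hδ, hT, hT0, hF, hlaw⟩ := h
  have hδ2 := left_ne_zero_of_mul hδ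
  have hδ4 := right_ne_zero_of_mul hδ
  have hAs : ContDiffOn ℝ ∞ A Φ.times := (contDiffOn_antiderivative hI hθ hA).mono hsub
  refine ⟨⟨hT, contDiffOn_const, ((contDiffOn_const.mul hAs).mul contDiffOn_const).add
    contDiffOn_const, hT0, fun t ht => inv_ne_zero hδ4, fun t x u hp => ?_⟩, hsub, hδ2,
    fun t ht => ?_, fun t ht => ?_, fun t x u hp => ?_, hlaw⟩
  · rw [hF t x u hp]
    exact ⟨rfl, by ring⟩
  · simpa using hasDerivAt_const t (δ 4)⁻¹
  · refine ((((hA t (hsub ht)).const_mul (δ 1)).mul_const (δ 4)⁻¹).add_const (δ 0)).congr_deriv ?_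
    field_simp
  · rw [hF t x u hp]
    field_simp
    ring

theorem CoefficientLaw.congr {J : Set ℝ} {δ : ℝ} {T T' X X' : ℝ → ℝ} (hJ : IsOpen J)
    (h : CoefficientLaw J δ T X θ θ') (hT : Set.EqOn T' T J) (hX : Set.EqOn X' X J) :
    CoefficientLaw J δ T' X' θ θ' := by
  intro t ht
  have : deriv T' t = deriv T t :=
    (hT.eventuallyEq_of_mem (hJ.mem_nhds ht)).deriv_eq
  rw [hT ht, hX ht, this]
  exact h t ht

/-- Integration of the determining equations. -/
theorem HasAffineForm.exists_form {δ c₀ c₁ : ℝ} {T X Y : ℝ → ℝ}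
    (hA : ∀ t ∈ I, HasDerivAt A (θ.α t) t) (h : HasAffineForm I θ Φ θ' δ c₀ c₁ T X Y) :
    ∃ (δ : Fin 5 → ℝ) (T : ℝ → ℝ),
      HasForm I θ A δ T Φ θ' ∨ HasGalileanForm I θ A δ T Φ θ' := by
  have hδ := h.ne
  have hX0 := h.base.X_ne
  -- The Riccati equation for `X` becomes `(1/X)' = -(c₁/δ) α`.
  have dX : ∀ t ∈ Φ.times, HasDerivAt (fun t => (X t)⁻¹ + c₁ / δ * A t) 0 t := fun t ht => by
    refine (((h.deriv_X t ht).inv (hX0 t ht)).add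
      ((hA t (h.times_subset ht)).const_mul (c₁ / δ))).congr_deriv ?_
    have := hX0 t ht
    field_simp
    ring
  obtain ⟨d, hd⟩ := LocalMap.eq_const_of_deriv_eq_zero (Φ := Φ)
    (fun t ht => (dX t ht).differentiableAt.differentiableWithinAt) fun t ht => (dX t ht).deriv
  have hXe : ∀ t ∈ Φ.times, X t = (-(c₁ / δ) * A t + d)⁻¹ := fun t ht => by
    rw [← hd t ht, ← inv_inj, inv_inv]
    ring
  have hne : ∀ t ∈ Φ.times, -(c₁ / δ) * A t + d ≠ 0 := fun t ht h0 => by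
    have := hXe t ht
    rw [h0, inv_zero] at this
    exact hX0 t ht this
  obtain ⟨⟨t₀, y₀⟩, hp₀⟩ := Φ.isConnected_dom.nonempty
  have ht₀ : t₀ ∈ Φ.times := ⟨_, hp₀, rfl⟩
  by_cases hc : c₁ = 0
  · have hd0 : d ≠ 0 := by simpa [hc] using hne t₀ ht₀
    have hXd : ∀ t ∈ Φ.times, X t = d⁻¹ := fun t ht => by rw [hXe t ht]; simp [hc]
    -- Here `X = 1/d`, so `Y' = c₀ α / (d² δ)` and `Y` involves `A` itself: the Galilean case, with
    -- `δ₁ = c₀/(d δ)`.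
    have dY : ∀ t ∈ Φ.times, HasDerivAt (fun t => Y t - c₀ / (d * δ) * A t * d⁻¹) 0 t := fun t ht => by
      refine ((h.deriv_Y t ht).sub
        (((hA t (h.times_subset ht)).const_mul (c₀ / (d * δ))).mul_const d⁻¹)).congr_deriv ?_
      rw [hXd t ht]
      field_simp
      ring
    obtain ⟨e, he⟩ := LocalMap.eq_const_of_deriv_eq_zero (Φ := Φ)
      (fun t ht => (dY t ht).differentiableAt.differentiableWithinAt) fun t ht => (dY t ht).deriv
    refine ⟨![e, c₀ / (d * δ), δ, 0, d], T, Or.inr ⟨h.times_subset, by simp, ?_, h.base.smooth_T,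
      h.base.deriv_ne, fun t x u hp => ?_, h.law.congr Φ.isOpen_times (fun _ _ => rfl)
      fun t ht => (hXd t ht).symm⟩⟩
    · exact mul_ne_zero hδ hd0
    · have ht : t ∈ Φ.times := ⟨_, hp, rfl⟩
      rw [h.toFun_eq hp, hXd t ht, hc]
      refine Prod.ext rfl (Prod.ext ?_ ?_)
      · change d⁻¹ * x + Y t = (x + c₀ / (d * δ) * A t) * d⁻¹ + e
        rw [← he t ht]; ring
      · change δ / d⁻¹ * u + 0 * x + c₀ = δ / d⁻¹ * (u + c₀ / (d * δ))
        field_simp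
        ring
  -- For `c₁ ≠ 0` the derivatives of `Y` and `X` have the constant ratio `c₀/c₁`, which becomes the
  -- shift `δ₁`.
  · have dY : ∀ t ∈ Φ.times, HasDerivAt (fun t => Y t - c₀ / c₁ * X t) 0 t := fun t ht => by
      refine ((h.deriv_Y t ht).sub ((h.deriv_X t ht).const_mul (c₀ / c₁))).congr_deriv ?_
      field_simp
      ring
    obtain ⟨e, he⟩ := LocalMap.eq_const_of_deriv_eq_zero (Φ := Φ)
      (fun t ht => (dY t ht).differentiableAt.differentiableWithinAt) fun t ht => (dY t ht).deriv
    refine ⟨![e, c₀ / c₁, δ, -(c₁ / δ), d], T, Or.inl ⟨h.times_subset, ?_, h.base.smooth_T,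
      h.base.deriv_ne, hne, fun t x u hp => ?_, h.law.congr Φ.isOpen_times (fun _ _ => rfl)
      fun t ht => (hXe t ht).symm⟩⟩
    · change δ * ((-(c₁ / δ)) ^ 2 + d ^ 2) ≠ 0
      have : 0 < (-(c₁ / δ)) ^ 2 := by
        have := neg_ne_zero.2 (div_ne_zero hc hδ)
        positivity
      exact mul_ne_zero hδ (by positivity)
    · have ht : t ∈ Φ.times := ⟨_, hp, rfl⟩
      rw [h.toFun_eq hp]
      refine Prod.ext rfl (Prod.ext ?_ ?_)
      · change X t * x + Y t = (x + c₀ / c₁) * (-(c₁ / δ) * A t + d)⁻¹ + e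
        rw [← hXe t ht, ← he t ht]; ring
      · change δ / X t * u + c₁ * x + c₀ = δ / (-(c₁ / δ) * A t + d)⁻¹ * u - δ * -(c₁ / δ) * (x + c₀ / c₁)
        rw [← hXe t ht]
        field_simp
        ring

/-- The parameters of an affine form are determined by the transformation. -/
theorem HasAffineForm.unique {θ₂ θ₂' : Coeffs} {Φ₂ : LocalMap} {δ c₀ c₁ δ₂ d₀ d₁ : ℝ}
    {T X Y T₂ X₂ Y₂ : ℝ → ℝ} (h : HasAffineForm I θ Φ θ' δ c₀ c₁ T X Y)
    (h₂ : HasAffineForm I θ₂ Φ₂ θ₂' δ₂ d₀ d₁ T₂ X₂ Y₂) (hdom : Φ₂.dom = Φ.dom)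
    (heq : Set.EqOn Φ₂.toFun Φ.toFun Φ.dom) :
    δ₂ = δ ∧ d₀ = c₀ ∧ d₁ = c₁ ∧ ∀ t ∈ Φ.times, T₂ t = T t ∧ X₂ t = X t ∧ Y₂ t = Y t := by
  have key : ∀ t ∈ Φ.times, d₀ = c₀ ∧ d₁ = c₁ ∧ δ₂ / X₂ t = δ / X t ∧
      T₂ t = T t ∧ X₂ t = X t ∧ Y₂ t = Y t := by
    rintro _ ⟨⟨t, x, u⟩, hp, rfl⟩
    have hnear : ∀ᶠ y : ℝ × ℝ in 𝓝 (x, u), (t, y) ∈ Φ.dom :=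
      (by fun_prop : ContinuousAt (fun y : ℝ × ℝ => (t, y)) (x, u)).eventually_mem
        (Φ.isOpen_dom.mem_nhds hp)
    have hform : ∀ y : ℝ × ℝ, (t, y) ∈ Φ.dom →
        T₂ t = T t ∧ X₂ t * y.1 + Y₂ t = X t * y.1 + Y t ∧
        δ₂ / X₂ t * y.2 + d₁ * y.1 + d₀ = δ / X t * y.2 + c₁ * y.1 + c₀ := fun y hy => by
      have := heq hy
      rw [h.toFun_eq hy, h₂.toFun_eq (by rwa [hdom])] at this
      simpa [Prod.ext_iff] using this
    -- Each time slice is open, so two affine functions of `(x, u)` that agree there have equal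
    -- coefficients.
    obtain ⟨a1, -, a3⟩ := coeffs_eq_zero_of_eventually (a := X₂ t - X t) (b := 0) (c := Y₂ t - Y t)
      (hnear.mono fun y hy => by linear_combination (hform y hy).2.1)
    obtain ⟨b1, b2, b3⟩ := coeffs_eq_zero_of_eventually (a := d₁ - c₁) (b := δ₂ / X₂ t - δ / X t)
      (c := d₀ - c₀) (hnear.mono fun y hy => by linear_combination (hform y hy).2.2)
    exact ⟨sub_eq_zero.1 b3, sub_eq_zero.1 b1, sub_eq_zero.1 b2, (hform _ hp).1, sub_eq_zero.1 a1,
      sub_eq_zero.1 a3⟩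
  obtain ⟨⟨t₀, y₀⟩, hp₀⟩ := Φ.isConnected_dom.nonempty
  have ht₀ : t₀ ∈ Φ.times := ⟨_, hp₀, rfl⟩
  obtain ⟨k0, k1, k2, -, k4, -⟩ := key t₀ ht₀
  rw [k4, div_left_inj' (h.base.X_ne t₀ ht₀)] at k2
  exact ⟨k2, k0, k1, fun t ht => (key t ht).2.2.2⟩

end

/-! ### Usual equivalence transformations -/

theorem Coeffs.inClass_const (I : Set ℝ) {a : ℝ} (ha : a ≠ 0) :
    (⟨fun _ => a, fun _ => 1, fun _ => 1⟩ : Coeffs).InClass I :=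
  ⟨⟨contDiffOn_const, contDiffOn_const, contDiffOn_const⟩, fun _ _ => ⟨ha, one_ne_zero, one_ne_zero⟩⟩

section Usual

variable {I : Set ℝ} {A : Coeffs → ℝ → ℝ} {τ : Coeffs → LocalMap × Coeffs}

/-- Equivalence transformations with a common part for the variables are scalings and shifts in `x`
and `u`. -/
theorem exists_common_form {Φ : LocalMap} (hτ : ∀ θ : Coeffs, θ.InClass I →
      (τ θ).1.dom = Φ.dom ∧ Set.EqOn (τ θ).1.toFun Φ.toFun Φ.dom ∧ Admissible I θ (τ θ).1 (τ θ).2) :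
    ∃ (δ : Fin 5 → ℝ) (T : ℝ → ℝ), δ 1 = 0 ∧ δ 3 = 0 ∧
      ∀ θ : Coeffs, θ.InClass I → HasForm I θ (A θ) δ T (τ θ).1 (τ θ).2 := by
  -- Two test equations, with `α = 1` and `α = 2`. They share `X`, `Y` and the constants, and
  -- comparing `X' = c₁ α X²/δ` and `Y' = c₀ α X²/δ` for both forces `c₁ = c₀ = 0`.
  set θ₁ : Coeffs := ⟨fun _ => 1, fun _ => 1, fun _ => 1⟩ with hθ₁
  set θ₂ : Coeffs := ⟨fun _ => 2, fun _ => 1, fun _ => 1⟩ with hθ₂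
  have hc₁ : θ₁.InClass I := Coeffs.inClass_const I one_ne_zero
  have hc₂ : θ₂.InClass I := Coeffs.inClass_const I two_ne_zero
  obtain ⟨δ, c₀, c₁, T, X, Y, h₁⟩ := (hτ θ₁ hc₁).2.2.exists_hasAffineForm hc₁
  have hdom : ∀ θ : Coeffs, θ.InClass I → (τ θ).1.dom = (τ θ₁).1.dom := fun θ hθ =>
    (hτ θ hθ).1.trans (hτ θ₁ hc₁).1.symm
  have heq : ∀ θ : Coeffs, θ.InClass I →
      Set.EqOn (τ θ).1.toFun (τ θ₁).1.toFun (τ θ₁).1.dom := fun θ hθ => by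
    rw [(hτ θ₁ hc₁).1]
    exact (hτ θ hθ).2.1.trans (hτ θ₁ hc₁).2.1.symm
  set J := (τ θ₁).1.times with hJ
  have hJo : IsOpen J := (τ θ₁).1.isOpen_times
  obtain ⟨⟨t₀, y₀⟩, hp₀⟩ := (τ θ₁).1.isConnected_dom.nonempty
  have ht₀ : t₀ ∈ J := ⟨_, hp₀, rfl⟩
  obtain ⟨δ', d₀, d₁, T₂, X₂, Y₂, h₂⟩ := (hτ θ₂ hc₂).2.2.exists_hasAffineForm hc₂
  obtain ⟨rfl, rfl, rfl, he⟩ := h₁.unique h₂ (hdom θ₂ hc₂) (heq θ₂ hc₂)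
  have ht₀' : t₀ ∈ (τ θ₂).1.times := by
    rw [LocalMap.times, hdom θ₂ hc₂]; exact ht₀
  have hδ := h₁.ne
  have hX0 := h₁.base.X_ne t₀ ht₀
  have eX : X₂ =ᶠ[𝓝 t₀] X := Filter.eventually_of_mem (hJo.mem_nhds ht₀) fun s hs => (he s hs).2.1
  have eY : Y₂ =ᶠ[𝓝 t₀] Y := Filter.eventually_of_mem (hJo.mem_nhds ht₀) fun s hs => (he s hs).2.2
  have k1 := (h₁.deriv_X t₀ ht₀).unique ((h₂.deriv_X t₀ ht₀').congr_of_eventuallyEq eX.symm)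
  have k0 := (h₁.deriv_Y t₀ ht₀).unique ((h₂.deriv_Y t₀ ht₀').congr_of_eventuallyEq eY.symm)
  rw [(he t₀ ht₀).2.1] at k1 k0
  simp only [hθ₁, hθ₂] at k1 k0
  field_simp at k1 k0
  have hd1 : d₁ = 0 := by linarith
  have hd0 : d₀ = 0 := by linarith
  obtain ⟨a, ha⟩ := LocalMap.eq_const_of_deriv_eq_zero (Φ := (τ θ₁).1)
    (h₁.base.smooth_X.differentiableOn (by simp))
    fun t ht => by rw [(h₁.deriv_X t ht).deriv, hd1]; simp
  obtain ⟨b, hb⟩ := LocalMap.eq_const_of_deriv_eq_zero (Φ := (τ θ₁).1)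
    (h₁.base.smooth_Y.differentiableOn (by simp))
    fun t ht => by rw [(h₁.deriv_Y t ht).deriv, hd0]; simp
  have ha0 : a ≠ 0 := by rw [← ha t₀ ht₀]; exact hX0
  refine ⟨![b, 0, δ', 0, a⁻¹], T, rfl, rfl, fun θ hθ => ?_⟩
  obtain ⟨δ'', e₀, e₁, T₃, X₃, Y₃, h₃⟩ := (hτ θ hθ).2.2.exists_hasAffineForm hθ
  obtain ⟨rfl, rfl, rfl, he₃⟩ := h₁.unique h₃ (hdom θ hθ) (heq θ hθ)
  have htimes : (τ θ).1.times = J := by rw [LocalMap.times, hdom θ hθ]; rfl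
  have hinv : ∀ t, ((0 : ℝ) * A θ t + a⁻¹)⁻¹ = a := fun t => by simp
  refine ⟨h₃.times_subset, ?_, ?_, ?_, ?_, fun t x u hp => ?_, ?_⟩
  · change δ'' * (0 ^ 2 + a⁻¹ ^ 2) ≠ 0
    have : 0 < a⁻¹ ^ 2 := by positivity
    exact mul_ne_zero hδ (by positivity)
  · rw [htimes]; exact h₁.base.smooth_T
  · rw [htimes]; exact h₁.base.deriv_ne
  · intro t ht
    change 0 * A θ t + a⁻¹ ≠ 0
    simpa using ha0
  · have ht : t ∈ J := ⟨_, hdom θ hθ ▸ hp, rfl⟩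
    rw [h₃.toFun_eq hp, (he₃ t ht).1, (he₃ t ht).2.1, (he₃ t ht).2.2, ha t ht, hb t ht, hd1, hd0]
    refine Prod.ext rfl (Prod.ext ?_ ?_)
    · change a * x + b = (x + 0) * (0 * A θ t + a⁻¹)⁻¹ + b
      rw [hinv]; ring
    · change δ'' / a * u + 0 * x + 0 = δ'' / (0 * A θ t + a⁻¹)⁻¹ * u - δ'' * 0 * (x + 0)
      rw [hinv]; ring
  · refine h₃.law.congr (τ θ).1.isOpen_times (fun t ht => ?_) fun t ht => ?_
    · rw [htimes] at ht
      exact (he₃ t ht).1.symm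
    · rw [htimes] at ht
      rw [(he₃ t ht).2.1, ha t ht]
      exact hinv t

/-- For `δ₃ = 0` the factor `X` is constant and the antiderivative of `α` disappears. The part for
the variables is then the same for all equations, and the coefficients are multiplied by
nonvanishing functions of `t`, so the joint map is triangular and nondegenerate. -/
theorem isUsualEquivalence_of_form (hI : IsOpen I)
    (hA : ∀ θ : Coeffs, θ.InClass I → ∀ t ∈ I, HasDerivAt (A θ) (θ.α t) t)
    {Ω : Set (ℝ × ℝ × ℝ)} (hΩ : ∀ θ : Coeffs, θ.InClass I → (τ θ).1.dom = Ω) {δ : Fin 5 → ℝ}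
    {T : ℝ → ℝ} (h3 : δ 3 = 0)
    (hF : ∀ θ : Coeffs, θ.InClass I → HasForm I θ (A θ) δ T (τ θ).1 (τ θ).2) :
    IsUsualEquivalence I τ := by
  set θ₁ : Coeffs := ⟨fun _ => 1, fun _ => 1, fun _ => 1⟩ with hθ₁
  have hc₁ : θ₁.InClass I := Coeffs.inClass_const I one_ne_zero
  set Φ := (τ θ₁).1 with hΦdef
  have hadm : ∀ θ : Coeffs, θ.InClass I → Admissible I θ (τ θ).1 (τ θ).2 := fun θ hθ =>
    ((hF θ hθ).hasAffineForm hI hθ (hA θ hθ)).admissible hθ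
  have hΦ : Φ.IsPointTransformation := (hadm θ₁ hc₁).1
  have hdom : ∀ θ : Coeffs, θ.InClass I → (τ θ).1.dom = Φ.dom := fun θ hθ =>
    (hΩ θ hθ).trans (hΩ θ₁ hc₁).symm
  obtain ⟨-, hδ, hT, hT0, -, hform, -⟩ := hF θ₁ hc₁
  have hδ2 := left_ne_zero_of_mul hδ
  have hδ4 : δ 4 ≠ 0 := by
    rintro h0
    simp [h3, h0] at hδ
  set m₁ : ℝ × ℝ × ℝ → ℝ := fun p => (δ 4)⁻¹ ^ 2 / (δ 2 * deriv T p.1) with hm₁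
  set m₂ : ℝ × ℝ × ℝ → ℝ := fun p => (δ 4)⁻¹ ^ 3 / deriv T p.1 with hm₂
  set m₃ : ℝ × ℝ × ℝ → ℝ := fun p => (δ 4)⁻¹ ^ 5 / deriv T p.1 with hm₃
  have hm : Set.MapsTo Prod.fst Φ.dom Φ.times := fun p hp => ⟨p, hp, rfl⟩
  have hT' : ContDiffOn ℝ ∞ (fun p : ℝ × ℝ × ℝ => deriv T p.1) Φ.dom :=
    (hT.deriv_of_isOpen Φ.isOpen_times (by simp)).comp contDiff_fst.contDiffOn hm
  have hT0' : ∀ p ∈ Φ.dom, deriv T p.1 ≠ 0 := fun p hp => hT0 _ (hm hp)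
  have s₁ : ContDiffOn ℝ ∞ m₁ Φ.dom := contDiffOn_const.div (contDiffOn_const.mul hT')
    fun p hp => mul_ne_zero hδ2 (hT0' p hp)
  have s₂ : ContDiffOn ℝ ∞ m₂ Φ.dom := contDiffOn_const.div hT' hT0'
  have s₃ : ContDiffOn ℝ ∞ m₃ Φ.dom := contDiffOn_const.div hT' hT0'
  have hi := inv_ne_zero hδ4
  have n₁ : ∀ p ∈ Φ.dom, m₁ p ≠ 0 := fun p hp =>
    div_ne_zero (pow_ne_zero _ hi) (mul_ne_zero hδ2 (hT0' p hp))
  have n₂ : ∀ p ∈ Φ.dom, m₂ p ≠ 0 := fun p hp => div_ne_zero (pow_ne_zero _ hi) (hT0' p hp)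
  have n₃ : ∀ p ∈ Φ.dom, m₃ p ≠ 0 := fun p hp => div_ne_zero (pow_ne_zero _ hi) (hT0' p hp)
  refine ⟨Φ, fun p a => (m₁ p * a.1, m₂ p * a.2.1, m₃ p * a.2.2), ⟨?_, ?_, ?_⟩, fun θ hθ =>
    ⟨hdom θ hθ, ?_, hadm θ hθ, ?_⟩⟩
  · have hfst : Set.MapsTo Prod.fst (Φ.dom ×ˢ nonzeroValues) Φ.dom := fun z hz => hz.1
    have c : ∀ {m : ℝ × ℝ × ℝ → ℝ}, ContDiffOn ℝ ∞ m Φ.dom →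
        ContDiffOn ℝ ∞ (fun z : (ℝ × ℝ × ℝ) × (ℝ × ℝ × ℝ) => m z.1) (Φ.dom ×ˢ nonzeroValues) :=
      fun hs => hs.comp contDiff_fst.contDiffOn hfst
    exact (hΦ.1.comp contDiff_fst.contDiffOn hfst).prodMk (((c s₁).mul (by fun_prop)).prodMk
      (((c s₂).mul (by fun_prop)).prodMk ((c s₃).mul (by fun_prop))))
  · rintro ⟨p, a⟩ ⟨hp, -⟩ ⟨p', a'⟩ ⟨hp', -⟩ he
    simp only [Prod.mk.injEq] at he
    obtain ⟨e0, e1, e2, e3⟩ := he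
    obtain rfl : p = p' := hΦ.2.1 hp hp' e0
    exact Prod.ext rfl (Prod.ext (mul_left_cancel₀ (n₁ p hp) e1)
      (Prod.ext (mul_left_cancel₀ (n₂ p hp) e2) (mul_left_cancel₀ (n₃ p hp) e3)))
  · rintro ⟨p, a⟩ ⟨hp, -⟩
    have c : ∀ {m : ℝ × ℝ × ℝ → ℝ}, ContDiffOn ℝ ∞ m Φ.dom →
        HasFDerivAt (fun z : (ℝ × ℝ × ℝ) × (ℝ × ℝ × ℝ) => m z.1)
          ((fderiv ℝ m p).comp (ContinuousLinearMap.fst ℝ _ _)) (p, a) := fun {m} hs =>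
      HasFDerivAt.comp (g := m) (p, a)
        (((hs.contDiffAt (Φ.isOpen_dom.mem_nhds hp)).differentiableAt (by simp)).hasFDerivAt)
        hasFDerivAt_fst
    have hd : HasFDerivAt (fun z : (ℝ × ℝ × ℝ) × (ℝ × ℝ × ℝ) =>
        (Φ.toFun z.1, (m₁ z.1 * z.2.1, m₂ z.1 * z.2.2.1, m₃ z.1 * z.2.2.2))) _ (p, a) :=
      (HasFDerivAt.comp (g := Φ.toFun) (p, a) (hΦ.hasFDerivAt hp) hasFDerivAt_fst).prodMk
        (((c s₁).mul hasFDerivAt_snd.fst).prodMk (((c s₂).mul hasFDerivAt_snd.snd.fst).prodMk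
          ((c s₃).mul hasFDerivAt_snd.snd.snd)))
    rw [hd.fderiv]
    refine bijective_of_forall_eq_zero _ fun v hv => ?_
    have e0 : fderiv ℝ Φ.toFun p v.1 = 0 := congrArg Prod.fst hv
    have e1 := congrArg (fun z => z.2.1) hv
    have e2 := congrArg (fun z => z.2.2.1) hv
    have e3 := congrArg (fun z => z.2.2.2) hv
    have v0 : v.1 = 0 := (hΦ.2.2 p hp).1 (e0.trans (map_zero _).symm)
    simp [v0, n₁ p hp] at e1
    simp [v0, n₂ p hp] at e2
    simp [v0, n₃ p hp] at e3
    exact Prod.ext v0 (Prod.ext e1 (Prod.ext e2 e3))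
  · rintro ⟨t, x, u⟩ hp
    rw [hform t x u hp, (hF θ hθ).2.2.2.2.2.1 t x u (by rw [hdom θ hθ]; exact hp)]
    simp [h3]
  · rintro ⟨t, x, u⟩ hp
    have ht : t ∈ (τ θ).1.times := ⟨(t, x, u), by rw [hdom θ hθ]; exact hp, rfl⟩
    obtain ⟨l1, l2, l3⟩ := (hF θ hθ).2.2.2.2.2.2 t ht
    rw [hform t x u hp]
    simp only [Coeffs.value, l1, l2, l3, hm₁, hm₂, hm₃, h3, zero_mul, zero_add]

end Usual

theorem theorem2 (I : Set ℝ) (hIopen : IsOpen I) (hIconn : I.OrdConnected) (hIne : I.Nonempty)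
    (A : Coeffs → ℝ → ℝ)
    (hA : ∀ θ : Coeffs, θ.InClass I → ∀ t ∈ I, HasDerivAt (A θ) (θ.α t) t) :
    -- the generalized extended equivalence transformations are those of the listed forms
    (∀ τ : Coeffs → LocalMap × Coeffs,
      IsGeneralizedExtendedEquivalence I τ ↔
        ∀ θ : Coeffs, θ.InClass I → ∃ (δ : Fin 5 → ℝ) (T : ℝ → ℝ),
          HasForm I θ (A θ) δ T (τ θ).1 (τ θ).2 ∨
            HasGalileanForm I θ (A θ) δ T (τ θ).1 (τ θ).2) ∧
    -- each choice of the constants and of the function `T` occurs, for the whole class at once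
    (∀ (δ : Fin 5 → ℝ) (T : ℝ → ℝ), ContDiffOn ℝ ∞ T I → (∀ t ∈ I, deriv T t ≠ 0) →
      (δ 2 * (δ 3 ^ 2 + δ 4 ^ 2) ≠ 0 →
        ∃ τ : Coeffs → LocalMap × Coeffs, IsGeneralizedExtendedEquivalence I τ ∧
          ∀ θ : Coeffs, θ.InClass I → HasForm I θ (A θ) δ T (τ θ).1 (τ θ).2) ∧
      (δ 3 = 0 → δ 2 * δ 4 ≠ 0 →
        ∃ τ : Coeffs → LocalMap × Coeffs, IsGeneralizedExtendedEquivalence I τ ∧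
          ∀ θ : Coeffs, θ.InClass I → HasGalileanForm I θ (A θ) δ T (τ θ).1 (τ θ).2)) ∧
    -- the usual equivalence transformations are those with `δ₁ = δ₃ = 0`
    (∀ τ : Coeffs → LocalMap × Coeffs,
      IsUsualEquivalence I τ ↔
        (∃ Ω : Set (ℝ × ℝ × ℝ), ∀ θ : Coeffs, θ.InClass I → (τ θ).1.dom = Ω) ∧
        ∃ (δ : Fin 5 → ℝ) (T : ℝ → ℝ), δ 1 = 0 ∧ δ 3 = 0 ∧
          ∀ θ : Coeffs, θ.InClass I → HasForm I θ (A θ) δ T (τ θ).1 (τ θ).2) := by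
  have hadm : ∀ (θ : Coeffs), θ.InClass I → ∀ (δ : Fin 5 → ℝ) (T : ℝ → ℝ) (P : LocalMap × Coeffs),
      HasForm I θ (A θ) δ T P.1 P.2 ∨ HasGalileanForm I θ (A θ) δ T P.1 P.2 →
      Admissible I θ P.1 P.2 := by
    rintro θ hθ δ T P (h | h)
    · exact (h.hasAffineForm hIopen hθ (hA θ hθ)).admissible hθ
    · exact (h.hasAffineForm hIopen hθ (hA θ hθ)).admissible hθ
  -- A rule must also have values off the class; any fixed pair serves there, and one exists because
  -- the class is nonempty.
  have extend : ∀ Q : Coeffs → LocalMap × Coeffs → Prop,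
      (∀ θ : Coeffs, θ.InClass I → ∃ P, Q θ P) →
      ∃ τ : Coeffs → LocalMap × Coeffs, ∀ θ : Coeffs, θ.InClass I → Q θ (τ θ) := by
    intro Q hQ
    obtain ⟨P₀, -⟩ := hQ _ (Coeffs.inClass_const I one_ne_zero)
    have : ∀ θ : Coeffs, ∃ P, θ.InClass I → Q θ P := fun θ => by
      by_cases hθ : θ.InClass I
      · exact (hQ θ hθ).imp fun P hP _ => hP
      · exact ⟨P₀, fun h => absurd h hθ⟩
    choose τ hτ using this
    exact ⟨τ, hτ⟩
  refine ⟨fun τ => ⟨fun hτ θ hθ => ?_, fun hτ θ hθ => ?_⟩, fun δ T hT hT0 => ⟨fun hδ => ?_,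
    fun h3 hδ => ?_⟩, fun τ => ⟨?_, ?_⟩⟩
  · obtain ⟨_, _, _, _, _, _, h⟩ := (hτ θ hθ).exists_hasAffineForm hθ
    exact h.exists_form (hA θ hθ)
  · obtain ⟨δ, T, h⟩ := hτ θ hθ
    exact hadm θ hθ δ T _ h
  · obtain ⟨τ, hτ⟩ := extend (fun θ P => HasForm I θ (A θ) δ T P.1 P.2) fun θ hθ =>
      exists_hasForm hIopen hIne hθ (hA θ hθ) δ T hT hT0 hδ
    exact ⟨τ, fun θ hθ => hadm θ hθ δ T _ (Or.inl (hτ θ hθ)), hτ⟩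
  · obtain ⟨τ, hτ⟩ := extend (fun θ P => HasGalileanForm I θ (A θ) δ T P.1 P.2) fun θ hθ =>
      exists_hasGalileanForm hIopen hIne hθ (hA θ hθ) δ T hT hT0 h3 hδ
    exact ⟨τ, fun θ hθ => hadm θ hθ δ T _ (Or.inr (hτ θ hθ)), hτ⟩
  · rintro ⟨Φ, F, -, hτ⟩
    exact ⟨⟨Φ.dom, fun θ hθ => (hτ θ hθ).1⟩,
      exists_common_form (Φ := Φ) fun θ hθ => ⟨(hτ θ hθ).1, (hτ θ hθ).2.1, (hτ θ hθ).2.2.1⟩⟩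
  · rintro ⟨⟨Ω, hΩ⟩, δ, T, -, h3, hF⟩
    exact isUsualEquivalence_of_form hIopen hA hΩ h3 hF
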